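/- Let $F=\bigcup_{j=1}^J\varphi_j(F)\subset\mathbb{R}^d$ ($J\ge 2$, $F$ nonempty and compact) be a self-similar fractal, where the $\varphi_j$ are similitudes of $\mathbb{R}^d$ with scaling ratios $0<r_j<1$. Let $C=[F]$ be the convex hull of $F$, and write $\Phi(C)=\bigcup_{j}\varphi_j(C)$. Assume: (a) $\dim C=d$; (b) (Tileset Condition) $\operatorname{int}C$ is a feasible open set for the open set condition, i.e. $\operatorname{int} C$ is nonempty and the sets $\varphi_j(\operatorname{int}C)$ are pairwise disjoint subsets of $\operatorname{int}C$; (c) (Nontriviality Condition) $\operatorname{int}C\nsubseteq\Phi(C)$; (d) (Pearse--Winter Condition) $\partial C\subset F$; (e) $T_0=C\setminus\Phi(C)$ has finitely many connected components $G_1,\dots,G_Q$ (the generators; in particular, there may be a single generator $G=T_0$), and each generator is a bounded open (diphase) Steiner-like set: with $g_q$ the inradius of $G_q$ (the supremum of the radii of the balls contained in $G_q$), there are real numbers $\kappa_m(G_q)$ such that $$V^-_{G_q}(\varepsilon):=\operatorname{vol}\{x\in\overline{G_q} : \operatorname{dist}(x,G_q^c)\le\varepsilon\}=\sum_{m=0}^{d-1}\kappa_m(G_q)\,\varepsilon^{d-m}\quad(0<\varepsilon<g_q),\qquad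 \kappa_d(G_q):=-\operatorname{vol}(G_q);$$ (f) $D>d-1$, where, with $V_F(\varepsilon)=\operatorname{vol}\{x:\operatorname{dist}(x,F)\le\varepsilon\}$, $D=\inf\{t\ge0 : V_F(\varepsilon)=O(\varepsilon^{d-t})\text{ as }\varepsilon\to0^+\}$ is the Minkowski dimension of $F$. Let $\zeta(s)=1/\bigl(1-\sum_{j}r_j^s\bigr)$ be the scaling zeta function, i.e. the meromorphic extension of $\sum_{n\ge0}\sum_{w\in\{1,\dots,J\}^n}(r_{w_1}\cdots r_{w_n})^s$ from $\operatorname{Re}s>D$ to $\mathbb{C}$, and put $$\zeta^q_{\mathcal T}(s,\varepsilon)=\zeta(s)\,\varepsilon^{d-s}\sum_{m=0}^d\frac{g_q^{s-m}}{s-m}\kappa_m(G_q),\qquad \zeta_{\mathcal T}=\sum_{q=1}^Q\zeta^q_{\mathcal T}.$$ Then $\sum_{j=1}^J r_j^D=1$ and $D=\lim_{\varepsilon\to0^+}\bigl(d-\log V_F(\varepsilon)/\log\varepsilon\bigr)$. Moreover, the residue $M:=\operatorname{res}(\zeta_{\mathcal T}(s,\varepsilon)\,\varepsilon^{s-d};D)$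 is a real number that does not depend on $\varepsilon>0$ and is given by $$M=\sum_{q=1}^Q\operatorname{res}\bigl(\zeta^q_{\mathcal T}(s,\varepsilon)\,\varepsilon^{s-d};D\bigr)=\operatorname{res}(\zeta;D)\sum_{q=1}^Q\sum_{m=0}^d\frac{g_q^{D-m}}{D-m}\kappa_m(G_q)=\frac{\sum_{q=1}^Q\sum_{m=0}^d\frac{g_q^{D-m}}{D-m}\kappa_m(G_q)}{\sum_{j=1}^J r_j^D\log r_j^{-1}},$$ and the following hold. I. If the IFS is of non-lattice type (the additive group generated by the numbers $\log r_j$ is not discrete), then $F$ is Minkowski measurable with Minkowski content $M$: $\lim_{\varepsilon\to0^+}V_F(\varepsilon)\,\varepsilon^{D-d}=M\neq0$. II. If the IFS is of lattice type (this group is discrete), then $F$ is not Minkowski measurable, i.e. $V_F(\varepsilon)\,\varepsilon^{D-d}$ has no finite nonzero limit as $\varepsilon\to0^+$; but its average Minkowski content exists and equals $M$: $$\lim_{T\to\infty}\frac1{\log T}\int_{1/T}^1\varepsilon^{-(d-D)}\,V_F(\varepsilon)\,\frac{d\varepsilon}{\varepsilon}=M.$$ -/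

import Mathlib

open Set Filter Topology MeasureTheory

noncomputable section

namespace Fractal

/-- `d`-dimensional Euclidean space. -/
abbrev Euc (d : ℕ) : Type := EuclideanSpace ℝ (Fin d)

/-! ## Self-similar sets -/

/-- A similitude of `ℝ^d` with scaling ratio `r`, where `0 < r < 1`. -/
def IsSimilitude {d : ℕ} (φ : Euc d → Euc d) (r : ℝ) : Prop :=
  0 < r ∧ r < 1 ∧ ∀ x y, dist (φ x) (φ y) = r * dist x y

/-- `F` is the self-similar fractal of the IFS `φ`: the nonempty compact set with
`F = ⋃ j, φ j (F)`. -/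
def IsAttractor {d J : ℕ} (φ : Fin J → Euc d → Euc d) (F : Set (Euc d)) : Prop :=
  F.Nonempty ∧ IsCompact F ∧ F = ⋃ j, φ j '' F

/-- `O` is a feasible open set for the open set condition of the IFS `φ`. -/
def IsFeasibleOpenSet {d J : ℕ} (φ : Fin J → Euc d → Euc d) (O : Set (Euc d)) : Prop :=
  IsOpen O ∧ O.Nonempty ∧ (∀ j, φ j '' O ⊆ O) ∧
    Pairwise (fun j k => Disjoint (φ j '' O) (φ k '' O))

/-- Tileset condition: the interior of the convex hull `C` of `F` is a feasible open set. -/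
def TilesetCondition {d J : ℕ} (φ : Fin J → Euc d → Euc d) (F : Set (Euc d)) : Prop :=
  IsFeasibleOpenSet φ (interior (convexHull ℝ F))

/-- Nontriviality condition: `int C` is not contained in `⋃ j, φ j (C)`. -/
def NontrivialityCondition {d J : ℕ} (φ : Fin J → Euc d → Euc d) (F : Set (Euc d)) : Prop :=
  ¬ interior (convexHull ℝ F) ⊆ ⋃ j, φ j '' convexHull ℝ F

/-- Pearse–Winter condition: the boundary of `C` is contained in `F`. -/
def PearseWinterCondition {d : ℕ} (F : Set (Euc d)) : Prop :=
  frontier (convexHull ℝ F) ⊆ F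

/-- The IFS with scaling ratios `r j` is of lattice type: the additive subgroup of `ℝ`
generated by the numbers `log (r j)` is discrete. -/
def IsLatticeType {J : ℕ} (r : Fin J → ℝ) : Prop :=
  DiscreteTopology (AddSubgroup.closure (Set.range fun j => Real.log (r j)))

/-! ## Minkowski dimension and content -/

/-- The volume `V_A(ε)` of the `ε`-neighbourhood `{x | dist (x, A) ≤ ε}`. -/
def tubeVolume {d : ℕ} (A : Set (Euc d)) (ε : ℝ) : ℝ :=
  volume.real (Metric.cthickening ε A)

/-- The (upper) Minkowski dimension
`inf {t ≥ 0 | V_A(ε) = O(ε ^ (d - t)) as ε → 0+}`. -/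
def minkowskiDim {d : ℕ} (A : Set (Euc d)) : ℝ :=
  sInf {t : ℝ | 0 ≤ t ∧
    (fun ε => tubeVolume A ε) =O[𝓝[>] 0] fun ε : ℝ => ε ^ ((d : ℝ) - t)}

/-- `A` is Minkowski measurable with Minkowski content `M`. -/
def HasMinkowskiContent {d : ℕ} (A : Set (Euc d)) (M : ℝ) : Prop :=
  M ≠ 0 ∧
    Tendsto (fun ε : ℝ => tubeVolume A ε * ε ^ (minkowskiDim A - d)) (𝓝[>] 0) (𝓝 M)

/-- `A` is Minkowski measurable. -/
def IsMinkowskiMeasurable {d : ℕ} (A : Set (Euc d)) : Prop :=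
  ∃ M : ℝ, HasMinkowskiContent A M

/-- The average Minkowski content of `A` exists and equals `M`. -/
def HasAverageMinkowskiContent {d : ℕ} (A : Set (Euc d)) (M : ℝ) : Prop :=
  Tendsto (fun T : ℝ => 1 / Real.log T *
      ∫ ε in (1 / T)..1, ε ^ (-((d : ℝ) - minkowskiDim A)) * tubeVolume A ε / ε)
    atTop (𝓝 M)

/-! ## Generators -/

/-- The volume `V⁻_A(ε)` of the inner `ε`-neighbourhood `{x ∈ closure A | dist (x, Aᶜ) ≤ ε}`. -/
def innerTubeVolume {d : ℕ} (A : Set (Euc d)) (ε : ℝ) : ℝ :=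
  volume.real (closure A ∩ Metric.cthickening ε Aᶜ)

/-- The inradius: the supremum of the radii of the balls contained in `A`. -/
def inradius {d : ℕ} (A : Set (Euc d)) : ℝ :=
  sSup {ρ : ℝ | 0 < ρ ∧ ∃ x, Metric.ball x ρ ⊆ A}

/-- `G` is a (diphase) Steiner-like set with coefficients `κ 0, …, κ d`; the last one is
minus the volume of `G`. -/
def IsSteinerLike {d : ℕ} (G : Set (Euc d)) (κ : ℕ → ℝ) : Prop :=
  Bornology.IsBounded G ∧ IsOpen G ∧
    (∀ ε : ℝ, 0 < ε → ε < inradius G →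
      innerTubeVolume G ε = ∑ m ∈ Finset.range d, κ m * ε ^ (d - m)) ∧
    κ d = -volume.real G

/-- The sets `G q` are the generators of the tiling: they are the finitely many connected
components of the open set `T₀ = C \ ⋃ j, φ j (C)`, i.e. open, connected, pairwise disjoint
sets with union `T₀`. -/
def AreGenerators {d J Q : ℕ} (φ : Fin J → Euc d → Euc d) (F : Set (Euc d))
    (G : Fin Q → Set (Euc d)) : Prop :=
  (∀ q, IsOpen (G q)) ∧ (∀ q, IsConnected (G q)) ∧
    Pairwise (fun q q' => Disjoint (G q) (G q')) ∧
    ⋃ q, G q = convexHull ℝ F \ ⋃ j, φ j '' convexHull ℝ F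

/-! ## Zeta functions and residues -/

/-- The scaling zeta function of the ratios `r j`: the meromorphic extension to `ℂ` of
`∑ n, ∑ w, (r_{w_1} ⋯ r_{w_n}) ^ s`, the inner sum being over the words of length `n`; see
`hasSum_scalingZeta` and `meromorphicAt_scalingZeta`. -/
def scalingZeta {J : ℕ} (r : Fin J → ℝ) (s : ℂ) : ℂ :=
  1 / (1 - ∑ j, (r j : ℂ) ^ s)

theorem meromorphicAt_scalingZeta {J : ℕ} {r : Fin J → ℝ} (hr : ∀ j, 0 < r j) (s : ℂ) :
    MeromorphicAt (scalingZeta r) s := by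
  have h : Differentiable ℂ fun z : ℂ => 1 - ∑ j, (r j : ℂ) ^ z := by
    refine (differentiable_const _).sub (Differentiable.fun_sum fun j _ => ?_)
    exact differentiable_id.const_cpow (Or.inl (by exact_mod_cast (hr j).ne'))
  exact (MeromorphicAt.const 1 s).div (h.analyticAt s).meromorphicAt

theorem hasSum_scalingZeta {J : ℕ} [NeZero J] {r : Fin J → ℝ} (hr : ∀ j, 0 < r j)
    (hr1 : ∀ j, r j < 1) {D : ℝ} (hD : ∑ j, r j ^ D = 1) {s : ℂ} (hs : D < s.re) :
    HasSum (fun n : ℕ => ∑ w : Fin n → Fin J, ((∏ i, r (w i) : ℝ) : ℂ) ^ s)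
      (scalingZeta r s) := by
  have hterm : ∀ n : ℕ, ∑ w : Fin n → Fin J, ((∏ i, r (w i) : ℝ) : ℂ) ^ s
      = (∑ j, (r j : ℂ) ^ s) ^ n := by
    intro n
    rw [Fintype.sum_pow]
    refine Finset.sum_congr rfl fun w _ => ?_
    rw [Complex.ofReal_prod]
    generalize (Finset.univ : Finset (Fin n)) = S
    induction S using Finset.cons_induction with
    | empty => simp
    | cons a S ha ih =>
      rw [Finset.prod_cons, Finset.prod_cons, ← Complex.ofReal_prod,
        Complex.mul_cpow_ofReal_nonneg (hr _).le (Finset.prod_nonneg fun i _ => (hr _).le),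
        Complex.ofReal_prod, ih]
  have hlt : ‖∑ j, (r j : ℂ) ^ s‖ < 1 := by
    refine (norm_sum_le _ _).trans_lt ?_
    rw [← hD]
    refine Finset.sum_lt_sum_of_nonempty ⟨0, Finset.mem_univ _⟩ fun j _ => ?_
    rw [Complex.norm_cpow_eq_rpow_re_of_pos (hr j)]
    exact Real.rpow_lt_rpow_of_exponent_gt (hr j) (hr1 j) hs
  simp_rw [hterm, scalingZeta, one_div]
  exact hasSum_geometric_of_norm_lt_one hlt

/-- The geometric zeta function
`ζ_T(s, ε) = ζ(s) ε ^ (d - s) ∑_{m = 0}^{d} g ^ (s - m) / (s - m) κ_m(G)`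
associated with a generator `G` with inradius `g`. -/
def geometricZeta {d J : ℕ} (r : Fin J → ℝ) (G : Set (Euc d)) (κ : ℕ → ℝ)
    (s : ℂ) (ε : ℝ) : ℂ :=
  scalingZeta r s * (ε : ℂ) ^ ((d : ℂ) - s) *
    ∑ m ∈ Finset.range (d + 1), (inradius G : ℂ) ^ (s - m) / (s - m) * (κ m : ℂ)

/-- The total geometric zeta function: the sum of those of the generators. -/
def totalGeometricZeta {d J Q : ℕ} (r : Fin J → ℝ) (G : Fin Q → Set (Euc d))
    (κ : Fin Q → ℕ → ℝ) (s : ℂ) (ε : ℝ) : ℂ :=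
  ∑ q, geometricZeta r (G q) (κ q) s ε

/-- `f` is meromorphic at `a` and has residue `c` there: `(2πi)⁻¹ ∮ f = c` over all
sufficiently small circles around `a`. -/
def HasResidueAt (f : ℂ → ℂ) (a c : ℂ) : Prop :=
  MeromorphicAt f a ∧
    ∀ᶠ ρ : ℝ in 𝓝[>] 0, (2 * (Real.pi : ℂ) * Complex.I)⁻¹ * (∮ z in C(a, ρ), f z) = c

end Fractal

end

/-! Let C be the convex hull of F and f(ε) (`hullTube`) the volume of the part of the
ε-neighbourhood of F inside C. Up to null sets, C is the disjoint union of the generators and the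
tiles φ_j(C). Since ∂C ⊂ F, a tile has its boundary in its own copy φ_j(F) and a generator has its
boundary in F, so distances to F measured inside a piece ignore everything beyond its boundary. This
gives f(ε) = Σ_q V⁻_{G_q}(ε) + Σ_j r_j^d f(ε/r_j) (`hullTube_eq`). The rest of the neighbourhood
lies in the outer collar of C and is O(ε), negligible against ε^(d-D) because D > d-1.

The generators have positive volume, so Σ r_j^d < 1 and the Moran equation has a root in (0, d).
Growth bounds for f, proved by induction over scales, identify this root with the Minkowski
dimension (`minkowskiDim_eq_of_moran`).

With t = -log ε and Z(t) = e^((d-D)t) f(e^(-t)), the functional equation becomes the renewal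
equation Z(t) = z(t) + Σ p_j Z(t - a_j), where p_j = r_j^D, a_j = log(1/r_j) and Σ p_j = 1.
Integrating it shows that Σ p_j ∫_{t-a_j}^t Z tends to ∫ z (`tendsto_sum_integral_renewal`), so the
mean of Z is always ∫ z / Σ p_j a_j. The Steiner formula evaluates ∫ z
(`integrable_logRescale_and_integral_eq`), and the quotient is the residue at the simple zero D of 1
- Σ r_j^s.

In the non-lattice case the a_j generate a dense group. Where Z is near its upper or lower limit, it
is near that limit on a fine net of a whole earlier window, which forces both limits to equal the
mean (`tendsto_of_renewal_of_dense`). In the lattice case, a combination of small translates of Z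
kills z on the lattice and therefore vanishes there. A limit of Z would then be 0
(`eq_zero_of_tendsto_of_lattice`). -/

open scoped Pointwise

namespace Fractal

/-! ### Similitudes -/

namespace IsSimilitude

variable {d : ℕ} {φ : Euc d → Euc d} {r : ℝ}

/-- Dividing by r gives an isometry, which is affine because the norm is strictly convex; equality
of dimensions makes its linear part bijective. -/
theorem exists_linearIsometryEquiv (h : IsSimilitude φ r) :
    ∃ (L : Euc d ≃ₗᵢ[ℝ] Euc d) (c : Euc d), ∀ x, φ x = c + r • L x := by
  obtain ⟨hr0, -, hd⟩ := h
  have hiso : Isometry fun x => r⁻¹ • φ x := by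
    refine Isometry.of_dist_eq fun x y => ?_
    rw [dist_smul₀, hd, Real.norm_of_nonneg (inv_nonneg.2 hr0.le), inv_mul_cancel_left₀ hr0.ne']
  set A := hiso.affineIsometryOfStrictConvexSpace with hA
  refine ⟨A.linearIsometry.toLinearIsometryEquiv rfl, φ 0, fun x => ?_⟩
  have h1 : A x = A.linearIsometry x + A 0 := by
    have := A.map_vadd 0 x
    simpa using this
  have h2 : ∀ y, A y = r⁻¹ • φ y := fun y => rfl
  rw [h2, h2] at h1
  have h3 : φ x = r • (A.linearIsometry x + r⁻¹ • φ 0) := by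
    rw [← h1, smul_inv_smul₀ hr0.ne']
  rw [h3, smul_add, smul_inv_smul₀ hr0.ne', add_comm]
  rfl

theorem exists_homeomorph (h : IsSimilitude φ r) : ∃ e : Euc d ≃ₜ Euc d, ⇑e = φ := by
  obtain ⟨L, c, hL⟩ := h.exists_linearIsometryEquiv
  refine ⟨(L.toHomeomorph.trans (Homeomorph.smulOfNeZero r h.1.ne')).trans
    (Homeomorph.addLeft c), ?_⟩
  ext1 x
  simp [hL]

theorem image_convexHull (h : IsSimilitude φ r) (s : Set (Euc d)) :
    φ '' convexHull ℝ s = convexHull ℝ (φ '' s) := by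
  obtain ⟨L, c, hL⟩ := h.exists_linearIsometryEquiv
  let A : Euc d →ᵃ[ℝ] Euc d :=
    AffineMap.const ℝ (Euc d) c + (r • (L.toLinearEquiv : Euc d →ₗ[ℝ] Euc d)).toAffineMap
  have hA : ⇑A = φ := by
    ext1 x
    simp [A, hL]
  rw [← hA, A.image_convexHull]

theorem image_interior (h : IsSimilitude φ r) (s : Set (Euc d)) :
    φ '' interior s = interior (φ '' s) := by
  obtain ⟨e, rfl⟩ := h.exists_homeomorph
  exact e.image_interior s

theorem image_frontier (h : IsSimilitude φ r) (s : Set (Euc d)) :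
    φ '' frontier s = frontier (φ '' s) := by
  obtain ⟨e, rfl⟩ := h.exists_homeomorph
  exact e.image_frontier s

theorem isClosed_image (h : IsSimilitude φ r) {s : Set (Euc d)} (hs : IsClosed s) :
    IsClosed (φ '' s) := by
  obtain ⟨e, rfl⟩ := h.exists_homeomorph
  exact e.isClosed_image.2 hs

theorem volumeReal_image (h : IsSimilitude φ r) (s : Set (Euc d)) :
    volume.real (φ '' s) = r ^ d * volume.real s := by
  obtain ⟨L, c, hL⟩ := h.exists_linearIsometryEquiv
  have hs : φ '' s = (fun x => c + x) '' (r • (L '' s)) := by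
    rw [← image_smul, image_image, image_image]
    exact image_congr fun x _ => hL x
  have hL' : volume (L '' s) = volume s := by
    rw [LinearIsometryEquiv.image_eq_preimage_symm]
    exact L.symm.measurePreserving.measure_preimage_emb
      L.symm.toHomeomorph.measurableEmbedding s
  rw [Measure.real, hs, image_add_left, measure_preimage_add, Measure.addHaar_smul, hL',
    finrank_euclideanSpace, Fintype.card_fin, abs_of_nonneg (by have := h.1; positivity),
    ENNReal.toReal_mul, ENNReal.toReal_ofReal (by have := h.1; positivity), Measure.real]

theorem mem_cthickening_image_iff (h : IsSimilitude φ r) (s : Set (Euc d)) (ε : ℝ) (x : Euc d) :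
    φ x ∈ Metric.cthickening ε (φ '' s) ↔ x ∈ Metric.cthickening (ε / r) s := by
  have hr := h.1
  have hed : ∀ y, edist (φ x) (φ y) = ENNReal.ofReal r * edist x y := fun y => by
    rw [edist_dist, h.2.2, ENNReal.ofReal_mul hr.le, edist_dist]
  have hinf : Metric.infEDist (φ x) (φ '' s) = ENNReal.ofReal r * Metric.infEDist x s := by
    simp only [Metric.infEDist, iInf_image, hed]
    rw [ENNReal.mul_iInf_of_ne (by simpa using hr) (by simp)]
    refine iInf_congr fun y => ?_
    rw [ENNReal.mul_iInf_of_ne (by simpa using hr) (by simp)]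
  rw [Metric.mem_cthickening_iff, Metric.mem_cthickening_iff, hinf,
    show ENNReal.ofReal ε = ENNReal.ofReal r * ENNReal.ofReal (ε / r) by
      rw [← ENNReal.ofReal_mul hr.le, mul_div_cancel₀ _ hr.ne'],
    ENNReal.mul_le_mul_iff_right (by simpa using hr) (by simp)]

end IsSimilitude

/-! ### Distances to a set containing a frontier -/

/-- Leaving S means crossing its frontier: if y ∉ S, the frontier point realising the distance from
x to Sᶜ is no farther away than y. -/
theorem infEDist_le_edist_of_frontier_subset {d : ℕ} {S A : Set (Euc d)} (h : frontier S ⊆ A)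
    {x y : Euc d} (hx : x ∈ S) (hy : y ∉ interior S) : Metric.infEDist x A ≤ edist x y := by
  by_cases hyS : y ∈ S
  · exact Metric.infEDist_le_edist_of_mem (h ⟨subset_closure hyS, hy⟩)
  · obtain ⟨z, hz, hzd⟩ := exists_mem_frontier_infDist_compl_eq_dist hx
      (fun hu => hyS (hu ▸ mem_univ y))
    refine (Metric.infEDist_le_edist_of_mem (h hz)).trans ?_
    rw [edist_dist, edist_dist, ← hzd]
    exact ENNReal.ofReal_le_ofReal (Metric.infDist_le_dist_of_mem hyS)

/-- This localises tubes. It is applied to a generator (S = G_q, A = F, B = G_qᶜ) and to a tile (S =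
φ_j(C), A = φ_j(F), B = F). -/
theorem inter_cthickening_eq_of_frontier_subset {d : ℕ} {S A B : Set (Euc d)}
    (h : frontier S ⊆ A) (hAB : A ⊆ B) (hB : ∀ y ∈ B, y ∈ A ∨ y ∉ interior S) (ε : ℝ) :
    S ∩ Metric.cthickening ε B = S ∩ Metric.cthickening ε A := by
  refine subset_antisymm (fun x hx => ⟨hx.1, ?_⟩)
    (inter_subset_inter_right _ (Metric.cthickening_subset_of_subset _ hAB))
  refine le_trans (Metric.le_infEDist.2 fun y hy => ?_) hx.2
  exact (hB y hy).elim Metric.infEDist_le_edist_of_mem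
    (infEDist_le_edist_of_frontier_subset h hx.1)

/-! ### The outer tube of a convex body -/

/-- If C contains the ball of radius ρ about x₀, a vector of length at most ε is ε/ρ times a vector
of that ball. As C + (ε/ρ)C = (1 + ε/ρ)C by convexity, the ε-neighbourhood lies in a translate of (1
+ ε/ρ)C, whose volume exceeds that of C by O(ε). -/
theorem exists_volumeReal_cthickening_le {d : ℕ} {C : Set (Euc d)} (hC : Convex ℝ C)
    (hcomp : IsCompact C) (hint : (interior C).Nonempty) :
    ∃ K : ℝ, 0 ≤ K ∧ ∀ ε : ℝ, 0 ≤ ε → ε ≤ 1 →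
      volume.real (Metric.cthickening ε C) ≤ volume.real C + K * ε := by
  obtain ⟨x₀, hx₀⟩ := hint
  obtain ⟨ρ, hρ, hball⟩ := Metric.nhds_basis_closedBall.mem_iff.1 (mem_interior_iff_mem_nhds.1 hx₀)
  refine ⟨volume.real C * (d * ρ⁻¹ * (1 + ρ⁻¹) ^ d), by positivity, fun ε h0 h1 => ?_⟩
  have hsub : Metric.cthickening ε C ⊆
      (fun x => (-(ε / ρ) • x₀) + x) '' ((1 + ε / ρ) • C) := by
    rw [hcomp.cthickening_eq_biUnion_closedBall h0]
    refine iUnion₂_subset fun y hy x hx => ?_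
    have hsm := hC.add_smul zero_le_one (show 0 ≤ ε / ρ by positivity)
    refine ⟨(ε / ρ) • x₀ + x, ?_, by simp⟩
    rw [hsm, one_smul]
    refine ⟨y, hy, (ε / ρ) • x₀ + (x - y), ?_, by simp only []; abel⟩
    rcases h0.eq_or_lt with rfl | hpos
    · refine ⟨x₀, interior_subset hx₀, ?_⟩
      have : x = y := by simpa using hx
      simp [this]
    · refine ⟨x₀ + (ρ / ε) • (x - y), hball ?_, ?_⟩
      · rw [mem_closedBall_iff_norm, add_sub_cancel_left, norm_smul,
          Real.norm_of_nonneg (by positivity)]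
        rw [mem_closedBall_iff_norm] at hx
        calc ρ / ε * ‖x - y‖ ≤ ρ / ε * ε := by gcongr
          _ = ρ := by field_simp
      · simp only [smul_add, smul_smul]
        rw [show ε / ρ * (ρ / ε) = 1 by field_simp, one_smul]
  have hfin : volume ((fun x => (-(ε / ρ) • x₀) + x) '' ((1 + ε / ρ) • C)) ≠ ⊤ := by
    rw [image_add_left, measure_preimage_add]
    exact (hcomp.smul _).measure_lt_top.ne
  refine (measureReal_mono hsub hfin).trans ?_
  rw [Measure.real, image_add_left, measure_preimage_add, Measure.addHaar_smul,
    finrank_euclideanSpace, Fintype.card_fin, abs_of_nonneg (by positivity),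
    ENNReal.toReal_mul, ENNReal.toReal_ofReal (by positivity)]
  change (1 + ε / ρ) ^ d * volume.real C ≤ _
  have hpow : (1 + ε / ρ) ^ d ≤ 1 + d * ρ⁻¹ * (1 + ρ⁻¹) ^ d * ε := by
    have hu0 : 0 ≤ ε / ρ := by positivity
    have hu1 : ε / ρ ≤ ρ⁻¹ := by rw [div_eq_mul_inv]; exact mul_le_of_le_one_left (by positivity) h1
    have key : ∀ n : ℕ, (1 + ε / ρ) ^ n ≤ 1 + n * (ε / ρ) * (1 + ρ⁻¹) ^ n := by
      intro n
      induction n with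
      | zero => simp
      | succ n ih =>
        have h2 : (1 + ε / ρ) ^ n ≤ (1 + ρ⁻¹) ^ (n + 1) :=
          (pow_le_pow_left₀ (by positivity) (by linarith) n).trans
            (pow_le_pow_right₀ (by linarith [inv_pos.2 hρ]) (Nat.le_succ n))
        have h3 : (1 + ρ⁻¹) ^ n ≤ (1 + ρ⁻¹) ^ (n + 1) :=
          pow_le_pow_right₀ (by linarith [inv_pos.2 hρ]) (Nat.le_succ n)
        have h4 : (n : ℝ) * (ε / ρ) * (1 + ρ⁻¹) ^ n ≤ n * (ε / ρ) * (1 + ρ⁻¹) ^ (n + 1) := by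
          gcongr
        have h5 : (1 + ε / ρ) ^ n * (ε / ρ) ≤ (1 + ρ⁻¹) ^ (n + 1) * (ε / ρ) := by gcongr
        push_cast
        rw [pow_succ, mul_add, mul_one]
        linarith
    refine (key d).trans (le_of_eq ?_)
    ring
  nlinarith [mul_le_mul_of_nonneg_right hpow (measureReal_nonneg (μ := volume) (s := C))]

/-! ### The convex hull of a self-similar set and its tiles -/

section Hull

variable {d J Q : ℕ} {φ : Fin J → Euc d → Euc d} {r : Fin J → ℝ} {F : Set (Euc d)}
  {G : Fin Q → Set (Euc d)}

/-- Closedness is immediate from ∂C ⊂ F ⊂ C. -/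
theorem IsAttractor.isCompact_convexHull (hF : IsAttractor φ F) (hPWC : PearseWinterCondition F) :
    IsCompact (convexHull ℝ F) := by
  refine Metric.isCompact_of_isClosed_isBounded (closure_subset_iff_isClosed.1 ?_)
    (isBounded_convexHull.2 hF.2.1.isBounded)
  rw [closure_eq_self_union_frontier]
  exact union_subset subset_rfl (hPWC.trans (subset_convexHull ℝ F))

theorem IsAttractor.image_subset (hF : IsAttractor φ F) (j : Fin J) : φ j '' F ⊆ F := by
  conv_rhs => rw [hF.2.2]
  exact subset_iUnion (fun j => φ j '' F) j

theorem IsAttractor.image_convexHull_subset (hφ : ∀ j, IsSimilitude (φ j) (r j))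
    (hF : IsAttractor φ F) (j : Fin J) : φ j '' convexHull ℝ F ⊆ convexHull ℝ F := by
  rw [(hφ j).image_convexHull]
  exact convexHull_mono (hF.image_subset j)

/-- The interiors are disjoint open sets, and a convex set with nonempty interior lies in the
closure of that interior. Hence tiles can overlap only in their frontiers. -/
theorem TilesetCondition.disjoint_interior_image (hφ : ∀ j, IsSimilitude (φ j) (r j))
    (hTSC : TilesetCondition φ F) {j k : Fin J} (hjk : j ≠ k) :
    Disjoint (φ k '' convexHull ℝ F) (interior (φ j '' convexHull ℝ F)) := by
  have hd := hTSC.2.2.2 hjk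
  simp only [(hφ _).image_interior] at hd
  have hcl : φ k '' convexHull ℝ F ⊆ closure (interior (φ k '' convexHull ℝ F)) := by
    have hc : Convex ℝ (φ k '' convexHull ℝ F) := by
      rw [(hφ k).image_convexHull]; exact convex_convexHull ℝ _
    rw [hc.closure_interior_eq_closure_of_nonempty_interior]
    · exact subset_closure
    · rw [← (hφ k).image_interior]; exact hTSC.2.1.image _
  exact ((hd.closure_right isOpen_interior).mono_right hcl).symm

/-- In dimension 0 the space is a point, so two images of a nonempty set cannot be disjoint. -/
theorem TilesetCondition.pos_dim (hJ : 2 ≤ J) (hTSC : TilesetCondition φ F) : 0 < d := by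
  rcases Nat.eq_zero_or_pos d with rfl | h
  · exfalso
    obtain ⟨x, hx⟩ := hTSC.2.1
    have hne : (⟨0, by omega⟩ : Fin J) ≠ ⟨1, by omega⟩ := by simp
    refine disjoint_left.1 (hTSC.2.2.2 hne) (mem_image_of_mem _ hx) ?_
    exact ⟨x, hx, Subsingleton.elim _ _⟩
  · exact h

theorem volume_frontier_image_convexHull (hφ : ∀ j, IsSimilitude (φ j) (r j)) (j : Fin J) :
    volume (frontier (φ j '' convexHull ℝ F)) = 0 := by
  rw [(hφ j).image_convexHull]
  exact (convex_convexHull ℝ _).addHaar_frontier volume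

theorem AreGenerators.subset_convexHull (hG : AreGenerators φ F G) (q : Fin Q) :
    G q ⊆ convexHull ℝ F :=
  (subset_iUnion G q).trans (hG.2.2.2.le.trans sdiff_subset)

theorem AreGenerators.disjoint_image (hG : AreGenerators φ F G) (q : Fin Q) (j : Fin J) :
    Disjoint (G q) (φ j '' convexHull ℝ F) :=
  disjoint_left.2 fun _ hx hxj =>
    (hG.2.2.2.le (mem_iUnion_of_mem q hx)).2 (mem_iUnion_of_mem j hxj)

/-- A frontier point of G_q lies in the closed set C but in no generator, since these are open and
disjoint. So it lies in a tile, and not in the interior of the tile, which is an open set missing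
G_q. -/
theorem AreGenerators.frontier_subset
    (hF : IsAttractor φ F) (hPWC : PearseWinterCondition F) (hG : AreGenerators φ F G)
    (q : Fin Q) : frontier (G q) ⊆ ⋃ j, frontier (φ j '' convexHull ℝ F) := by
  intro x hx
  have hxC : x ∈ convexHull ℝ F :=
    closure_minimal (hG.subset_convexHull q) (hF.isCompact_convexHull hPWC).isClosed hx.1
  have hxT : x ∉ ⋃ q, G q := by
    intro hmem
    obtain ⟨q', hq'⟩ := mem_iUnion.1 hmem
    by_cases hqq : q' = q
    · subst hqq
      exact hx.2 (by rwa [(hG.1 q').interior_eq])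
    · exact disjoint_left.1 ((hG.2.2.1 hqq).closure_right (hG.1 q')) hq' hx.1
  have hxΦ : x ∈ ⋃ j, φ j '' convexHull ℝ F := by
    by_contra hcon
    exact hxT (hG.2.2.2.ge ⟨hxC, hcon⟩)
  obtain ⟨j, hj⟩ := mem_iUnion.1 hxΦ
  refine mem_iUnion_of_mem j ⟨subset_closure hj, fun hint => ?_⟩
  exact disjoint_left.1 (((hG.disjoint_image q j).mono_right interior_subset).closure_left
    isOpen_interior) hx.1 hint

theorem frontier_image_convexHull_subset (hφ : ∀ j, IsSimilitude (φ j) (r j))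
    (hPWC : PearseWinterCondition F) (j : Fin J) :
    frontier (φ j '' convexHull ℝ F) ⊆ φ j '' F := by
  rw [← (hφ j).image_frontier]
  exact image_mono hPWC

theorem AreGenerators.volume_frontier (hφ : ∀ j, IsSimilitude (φ j) (r j))
    (hF : IsAttractor φ F) (hPWC : PearseWinterCondition F) (hG : AreGenerators φ F G)
    (q : Fin Q) : volume (frontier (G q)) = 0 :=
  measure_mono_null (hG.frontier_subset hF hPWC q)
    (measure_iUnion_null (volume_frontier_image_convexHull hφ))

/-- Generators are disjoint from each other and from the tiles; tiles overlap only in frontiers of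
convex sets, which are null. The choice A = univ compares volumes, and A = the tube of F yields the
functional equation. -/
theorem volumeReal_convexHull_inter (hφ : ∀ j, IsSimilitude (φ j) (r j))
    (hF : IsAttractor φ F) (hTSC : TilesetCondition φ F) (hPWC : PearseWinterCondition F)
    (hG : AreGenerators φ F G) {A : Set (Euc d)} (hA : MeasurableSet A) :
    volume.real (convexHull ℝ F ∩ A) =
      ∑ q, volume.real (G q ∩ A) + ∑ j, volume.real (φ j '' convexHull ℝ F ∩ A) := by
  have hC := hF.isCompact_convexHull hPWC
  have hfin : ∀ B ⊆ convexHull ℝ F, volume (B ∩ A) ≠ ⊤ := fun B hB =>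
    (measure_mono (inter_subset_left.trans hB)).trans_lt hC.measure_lt_top |>.ne
  have hmeas : ∀ j, MeasurableSet (φ j '' convexHull ℝ F) := fun j =>
    ((hφ j).isClosed_image hC.isClosed).measurableSet
  have hU : convexHull ℝ F ∩ A =
      (⋃ q, G q ∩ A) ∪ ⋃ j ∈ Finset.univ, φ j '' convexHull ℝ F ∩ A := by
    simp only [Finset.mem_univ, iUnion_true]
    rw [← iUnion_inter, ← iUnion_inter, hG.2.2.2, ← union_inter_distrib_right,
      sdiff_union_of_subset (iUnion_subset (hF.image_convexHull_subset hφ))]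
  have hsub : ∀ j, φ j '' convexHull ℝ F ∩ A ⊆ convexHull ℝ F ∩ A := fun j =>
    inter_subset_inter_left _ (hF.image_convexHull_subset hφ j)
  have hdisj : Disjoint (⋃ q, G q ∩ A) (⋃ j ∈ Finset.univ, φ j '' convexHull ℝ F ∩ A) := by
    simp only [disjoint_iUnion_left, disjoint_iUnion_right]
    exact fun j _ q => (hG.disjoint_image q j).mono inter_subset_left inter_subset_left
  rw [hU, measureReal_union hdisj
    (MeasurableSet.biUnion (to_countable _) fun j _ => (hmeas j).inter hA)
    ((measure_mono (iUnion_subset fun q =>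
      inter_subset_left.trans (hG.subset_convexHull q))).trans_lt hC.measure_lt_top).ne
    ((measure_mono (iUnion₂_subset fun j _ =>
      (hsub j).trans inter_subset_left)).trans_lt hC.measure_lt_top).ne,
    measureReal_iUnion_fintype
      (fun q q' hqq => (hG.2.2.1 hqq).mono inter_subset_left inter_subset_left)
      (fun q => (hG.1 q).measurableSet.inter hA) (fun q => hfin _ (hG.subset_convexHull q)),
    measureReal_biUnion_finset₀ _
      (fun j _ => ((hmeas j).inter hA).nullMeasurableSet)
      (fun j _ => hfin _ (hF.image_convexHull_subset hφ j))]
  intro j _ k _ hjk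
  refine measure_mono_null (t := frontier (φ j '' convexHull ℝ F)) ?_
    (volume_frontier_image_convexHull hφ j)
  rintro x ⟨hxj, hxk⟩
  exact ⟨subset_closure hxj.1,
    disjoint_left.1 (hTSC.disjoint_interior_image hφ hjk) hxk.1⟩

theorem AreGenerators.nonempty_index (hNTC : NontrivialityCondition φ F)
    (hG : AreGenerators φ F G) : Nonempty (Fin Q) := by
  obtain ⟨x, hx, hxn⟩ := not_subset.1 hNTC
  obtain ⟨q, -⟩ := mem_iUnion.1 (hG.2.2.2.ge ⟨interior_subset hx, hxn⟩)
  exact ⟨q⟩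

theorem AreGenerators.volumeReal_pos (hF : IsAttractor φ F) (hPWC : PearseWinterCondition F)
    (hG : AreGenerators φ F G) (q : Fin Q) : 0 < volume.real (G q) := by
  refine ENNReal.toReal_pos ((hG.1 q).measure_pos volume (hG.2.1 q).nonempty).ne' ?_
  exact ((measure_mono (hG.subset_convexHull q)).trans_lt
    (hF.isCompact_convexHull hPWC).measure_lt_top).ne

/-- The tiles fill the share Σ r_j^d of the volume of C, and nontriviality leaves a generator of
positive volume outside them. -/
theorem sum_pow_dim_lt_one (hφ : ∀ j, IsSimilitude (φ j) (r j))
    (hF : IsAttractor φ F) (hTSC : TilesetCondition φ F) (hNTC : NontrivialityCondition φ F)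
    (hPWC : PearseWinterCondition F) (hG : AreGenerators φ F G) : ∑ j, r j ^ d < 1 := by
  have h := volumeReal_convexHull_inter hφ hF hTSC hPWC hG MeasurableSet.univ
  simp only [inter_univ, (hφ _).volumeReal_image] at h
  rw [← Finset.sum_mul] at h
  have := hG.nonempty_index hNTC
  have hpos : 0 < ∑ q, volume.real (G q) :=
    Finset.sum_pos (fun q _ => hG.volumeReal_pos hF hPWC q) Finset.univ_nonempty
  by_contra! hcon
  nlinarith [measureReal_nonneg (μ := volume) (s := convexHull ℝ F)]

/-- The volume of the part of the `ε`-neighbourhood of `A` inside the convex hull of `A`. -/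
noncomputable def hullTube {d : ℕ} (A : Set (Euc d)) (ε : ℝ) : ℝ :=
  volume.real (convexHull ℝ A ∩ Metric.cthickening ε A)

theorem AreGenerators.volumeReal_inter_cthickening_compl (hφ : ∀ j, IsSimilitude (φ j) (r j))
    (hF : IsAttractor φ F) (hPWC : PearseWinterCondition F)
    (hG : AreGenerators φ F G) (q : Fin Q) (ε : ℝ) :
    volume.real (G q ∩ Metric.cthickening ε (G q)ᶜ) = innerTubeVolume (G q) ε := by
  have hnull : volume ((closure (G q) ∩ Metric.cthickening ε (G q)ᶜ) \
      (G q ∩ Metric.cthickening ε (G q)ᶜ)) = 0 := by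
    refine measure_mono_null ?_ (hG.volume_frontier hφ hF hPWC q)
    rintro x ⟨⟨hx1, hx2⟩, hx3⟩
    exact ⟨hx1, fun hx4 => hx3 ⟨interior_subset hx4, hx2⟩⟩
  exact measureReal_eq_measureReal_of_null_sdiff (inter_subset_inter_left _ subset_closure)
    (by rw [Measure.real, hnull, ENNReal.toReal_zero]) (by rw [hnull]; exact ENNReal.zero_ne_top)

theorem AreGenerators.volumeReal_inter_cthickening (hφ : ∀ j, IsSimilitude (φ j) (r j))
    (hF : IsAttractor φ F) (hPWC : PearseWinterCondition F)
    (hG : AreGenerators φ F G) (q : Fin Q) (ε : ℝ) :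
    volume.real (G q ∩ Metric.cthickening ε F) = innerTubeVolume (G q) ε := by
  have hFd : F ⊆ (G q)ᶜ := by
    intro x hx hxG
    rw [hF.2.2] at hx
    obtain ⟨j, hj⟩ := mem_iUnion.1 hx
    exact disjoint_left.1 (hG.disjoint_image q j) hxG
      (image_mono (_root_.subset_convexHull ℝ F) hj)
  rw [← inter_cthickening_eq_of_frontier_subset (A := F) (B := (G q)ᶜ) (S := G q) _ hFd _ ε,
    hG.volumeReal_inter_cthickening_compl hφ hF hPWC]
  · refine (hG.frontier_subset hF hPWC q).trans (iUnion_subset fun j => ?_)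
    exact (frontier_image_convexHull_subset hφ hPWC j).trans (hF.image_subset j)
  · exact fun y hy => Or.inr fun hyi => hy (interior_subset hyi)

theorem hullTube_eq (hφ : ∀ j, IsSimilitude (φ j) (r j))
    (hF : IsAttractor φ F) (hTSC : TilesetCondition φ F) (hPWC : PearseWinterCondition F)
    (hG : AreGenerators φ F G) (ε : ℝ) :
    hullTube F ε = ∑ q, innerTubeVolume (G q) ε + ∑ j, r j ^ d * hullTube F (ε / r j) := by
  rw [hullTube, volumeReal_convexHull_inter hφ hF hTSC hPWC hG
    Metric.isClosed_cthickening.measurableSet]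
  congr 1
  · exact Finset.sum_congr rfl fun q _ => hG.volumeReal_inter_cthickening hφ hF hPWC q ε
  · refine Finset.sum_congr rfl fun j _ => ?_
    rw [inter_cthickening_eq_of_frontier_subset (A := φ j '' F)
      (frontier_image_convexHull_subset hφ hPWC j) (hF.image_subset j), hullTube,
      ← (hφ j).volumeReal_image]
    · congr 1
      ext x
      constructor
      · rintro ⟨⟨y, hy, rfl⟩, hyc⟩
        exact ⟨y, ⟨hy, ((hφ j).mem_cthickening_image_iff F ε y).1 hyc⟩, rfl⟩
      · rintro ⟨y, ⟨hy, hyc⟩, rfl⟩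
        exact ⟨⟨y, hy, rfl⟩, ((hφ j).mem_cthickening_image_iff F ε y).2 hyc⟩
    -- A point of F outside φ_j(F) belongs to another tile, hence is not interior to φ_j(C).
    · intro y hy
      rw [hF.2.2] at hy
      obtain ⟨k, hk⟩ := mem_iUnion.1 hy
      by_cases hjk : j = k
      · exact Or.inl (hjk ▸ hk)
      · exact Or.inr (disjoint_left.1 (hTSC.disjoint_interior_image hφ hjk)
          (image_mono (_root_.subset_convexHull ℝ F) hk))

theorem IsAttractor.volume_hullTube_ne_top (hF : IsAttractor φ F)
    (hPWC : PearseWinterCondition F) (ε : ℝ) :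
    volume (convexHull ℝ F ∩ Metric.cthickening ε F) ≠ ⊤ :=
  ((measure_mono inter_subset_left).trans_lt (hF.isCompact_convexHull hPWC).measure_lt_top).ne

theorem IsAttractor.hullTube_mono (hF : IsAttractor φ F) (hPWC : PearseWinterCondition F) :
    Monotone (hullTube F) := fun _ ε' h =>
  measureReal_mono (inter_subset_inter_right _ (Metric.cthickening_mono h F))
    (hF.volume_hullTube_ne_top hPWC ε')

theorem IsAttractor.hullTube_le (hF : IsAttractor φ F) (hPWC : PearseWinterCondition F) (ε : ℝ) :
    hullTube F ε ≤ volume.real (convexHull ℝ F) :=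
  measureReal_mono inter_subset_left (hF.isCompact_convexHull hPWC).measure_lt_top.ne

theorem IsAttractor.hullTube_pos (hF : IsAttractor φ F) (hTSC : TilesetCondition φ F)
    (hPWC : PearseWinterCondition F) {ε : ℝ} (hε : 0 < ε) : 0 < hullTube F ε := by
  obtain ⟨x, hx⟩ := hF.1
  have hxc : x ∈ closure (interior (convexHull ℝ F)) := by
    rw [(convex_convexHull ℝ F).closure_interior_eq_closure_of_nonempty_interior hTSC.2.1]
    exact subset_closure (subset_convexHull ℝ F hx)
  obtain ⟨y, hy1, hy2⟩ := mem_closure_iff.1 hxc _ Metric.isOpen_ball (Metric.mem_ball_self hε)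
  refine ENNReal.toReal_pos (ne_of_gt ?_) (hF.volume_hullTube_ne_top hPWC ε)
  refine ((Metric.isOpen_ball.inter isOpen_interior).measure_pos volume
    ⟨y, hy1, hy2⟩).trans_le (measure_mono ?_)
  rintro z ⟨hz1, hz2⟩
  exact ⟨interior_subset hz2,
    Metric.mem_cthickening_of_dist_le z x ε F hx (Metric.mem_ball.1 hz1).le⟩

theorem IsAttractor.hullTube_le_tubeVolume (hF : IsAttractor φ F) (ε : ℝ) :
    hullTube F ε ≤ tubeVolume F ε :=
  measureReal_mono inter_subset_right hF.2.1.cthickening.measure_lt_top.ne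

theorem IsAttractor.exists_tubeVolume_le (hF : IsAttractor φ F) (hTSC : TilesetCondition φ F)
    (hPWC : PearseWinterCondition F) :
    ∃ K : ℝ, 0 ≤ K ∧ ∀ ε, 0 ≤ ε → ε ≤ 1 → tubeVolume F ε ≤ hullTube F ε + K * ε := by
  have hC := hF.isCompact_convexHull hPWC
  obtain ⟨K, hK, h⟩ := exists_volumeReal_cthickening_le (convex_convexHull ℝ F) hC hTSC.2.1
  refine ⟨K, hK, fun ε h0 h1 => ?_⟩
  have hsub : Metric.cthickening ε F ⊆ (convexHull ℝ F ∩ Metric.cthickening ε F) ∪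
      (Metric.cthickening ε (convexHull ℝ F) \ convexHull ℝ F) := fun x hx => by
    by_cases hxC : x ∈ convexHull ℝ F
    · exact Or.inl ⟨hxC, hx⟩
    · exact Or.inr ⟨Metric.cthickening_subset_of_subset _ (subset_convexHull ℝ F) hx, hxC⟩
  have hfin := hC.cthickening (r := ε) |>.measure_lt_top (μ := volume) |>.ne
  refine (measureReal_mono hsub (measure_union_ne_top (hF.volume_hullTube_ne_top hPWC ε)
    (measure_ne_top_of_subset sdiff_subset hfin))).trans ((measureReal_union_le _ _).trans ?_)
  rw [measureReal_sdiff (Metric.self_subset_cthickening _) hC.measurableSet hfin]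
  have := h ε h0 h1
  rw [hullTube]
  linarith

end Hull

/-! ### Steiner-like sets -/

/-- Makes the `sSup` in `inradius` a genuine supremum. In dimension 0 balls of all radii coincide,
so the radii would be unbounded. -/
theorem bddAbove_radii {d : ℕ} (hd : 0 < d) {G : Set (Euc d)} (hG : Bornology.IsBounded G) :
    BddAbove {ρ : ℝ | 0 < ρ ∧ ∃ x, Metric.ball x ρ ⊆ G} := by
  have : Nonempty (Fin d) := ⟨⟨0, hd⟩⟩
  refine ⟨2 * Metric.diam G, ?_⟩
  rintro ρ ⟨hρ, x, hx⟩
  obtain ⟨v, hv⟩ := exists_norm_eq (Euc d) (show 0 ≤ ρ / 2 by positivity)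
  have := Metric.dist_le_diam_of_mem hG (x := x + v) (y := x) (hx (by simp [hv, hρ]))
    (hx (Metric.mem_ball_self hρ))
  simp only [dist_self_add_left, hv] at this
  linarith

theorem inradius_pos {d : ℕ} (hd : 0 < d) {G : Set (Euc d)} (hG : Bornology.IsBounded G)
    (hopen : IsOpen G) (hne : G.Nonempty) : 0 < inradius G := by
  obtain ⟨x, hx⟩ := hne
  obtain ⟨ρ, hρ, hball⟩ := Metric.isOpen_iff.1 hopen x hx
  exact hρ.trans_le (le_csSup (bddAbove_radii hd hG) ⟨hρ, x, hball⟩)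

/-- The open ball about x of radius dist(x, Gᶜ) lies in G, so this distance never exceeds the
inradius. Beyond the inradius the inner tube is therefore all of G. -/
theorem inter_cthickening_compl_eq {d : ℕ} (hd : 0 < d) {G : Set (Euc d)}
    (hG : Bornology.IsBounded G) {ε : ℝ} (hε : inradius G ≤ ε) :
    G ∩ Metric.cthickening ε Gᶜ = G := by
  refine inter_eq_left.2 fun x hx => ?_
  have : Nonempty (Fin d) := ⟨⟨0, hd⟩⟩
  have hne : (Gᶜ).Nonempty := by
    rw [nonempty_compl]
    rintro rfl
    exact NormedSpace.unbounded_univ ℝ (Euc d) hG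
  have hle : Metric.infDist x Gᶜ ≤ ε := by
    rcases (Metric.infDist_nonneg (x := x) (s := Gᶜ)).eq_or_lt with h0 | h0
    · rw [← h0]
      refine le_trans ?_ hε
      exact Real.sSup_nonneg fun ρ hρ => hρ.1.le
    · exact (le_csSup (bddAbove_radii hd hG)
        ⟨h0, x, Metric.ball_infDist_compl_subset⟩).trans hε
  rw [Metric.mem_cthickening_iff, ← ENNReal.ofReal_toReal (Metric.infEDist_ne_top hne)]
  exact ENNReal.ofReal_le_ofReal hle

/-! ### The renewal equation -/

section Renewal

variable {J : ℕ} {p a : Fin J → ℝ} {Z z : ℝ → ℝ} {I : ℝ}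

/-- Induction along the steps `a j`. -/
theorem forall_of_forall_sub (ha : ∀ j, 0 < a j) {P : ℝ → Prop} {T : ℝ}
    (base : ∀ t ≤ T, P t) (step : ∀ t, T < t → (∀ j, P (t - a j)) → P t) (t : ℝ) : P t := by
  obtain ⟨a₀, ha₀, h0⟩ : ∃ a₀ : ℝ, (∀ j, a₀ < a j) ∧ a₀ ∈ Ioi (0 : ℝ) :=
    ((eventually_all.2 fun j => nhdsWithin_le_nhds (eventually_lt_nhds (ha j))).and
      (self_mem_nhdsWithin (a := (0 : ℝ)) (s := Ioi 0))).exists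
  have key : ∀ n : ℕ, ∀ t ≤ T + n * a₀, P t := by
    intro n
    induction n with
    | zero => simpa using base
    | succ n ih =>
      intro t ht
      rcases le_or_gt t T with h | h
      · exact base t h
      · refine step t h fun j => ih _ ?_
        push_cast at ht
        linarith [ha₀ j]
  obtain ⟨n, hn⟩ := exists_nat_ge ((t - T) / a₀)
  refine key n t ?_
  have := (div_le_iff₀ h0).1 hn
  linarith

/-- Formally the derivative of W(t) = Σ p_j ∫_{t-a_j}^t Z is Z(t) - Σ p_j Z(t - a_j) = z(t), because
Σ p_j = 1. Thus W(t) - W(s) is the integral of z from s to t, and W vanishes at -∞. -/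
theorem tendsto_sum_integral_renewal (hp1 : ∑ j, p j = 1)
    (hrec : ∀ t, Z t = z t + ∑ j, p j * Z (t - a j)) (ha : ∀ j, 0 < a j)
    (hint : ∀ s t, IntervalIntegrable Z volume s t) (hz : Integrable z)
    (hbot : Tendsto Z atBot (𝓝 0)) :
    Tendsto (fun t => ∑ j, p j * ∫ u in (t - a j)..t, Z u) atTop (𝓝 (∫ t, z t)) := by
  set W : ℝ → ℝ := fun t => ∑ j, p j * ∫ u in (t - a j)..t, Z u with hW
  have hshift : ∀ j s t, IntervalIntegrable (fun u => Z (u - a j)) volume s t := fun j s t => by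
    simpa using (hint (s - a j) (t - a j)).comp_sub_right (a j)
  have hdiff : ∀ s t, ∫ u in s..t, z u = W t - W s := by
    intro s t
    have h1 : ∀ u, z u = Z u - ∑ j, p j * Z (u - a j) := fun u => by rw [hrec u]; ring
    simp_rw [h1]
    rw [intervalIntegral.integral_sub (hint s t)
      (by
        have := IntervalIntegrable.sum Finset.univ
          (fun j (_ : j ∈ Finset.univ) => (hshift j s t).const_mul (p j))
        simpa only [Finset.sum_fn] using this),
      intervalIntegral.integral_finsetSum fun j _ => (hshift j s t).const_mul (p j)]
    simp only [intervalIntegral.integral_const_mul, intervalIntegral.integral_comp_sub_right]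
    rw [hW]
    simp only []
    rw [← Finset.sum_sub_distrib,
      show ∫ u in s..t, Z u = ∑ j, p j * ∫ u in s..t, Z u by rw [← Finset.sum_mul, hp1, one_mul],
      ← Finset.sum_sub_distrib]
    refine Finset.sum_congr rfl fun j _ => ?_
    rw [← mul_sub, ← mul_sub, intervalIntegral.integral_interval_sub_interval_comm
      (hint _ _) (hint _ _) (hint _ _), intervalIntegral.integral_symm (s - a j) s,
      intervalIntegral.integral_symm (t - a j) t]
    ring
  have hWbot : Tendsto W atBot (𝓝 0) := by
    rw [show (0 : ℝ) = ∑ j, p j * 0 by simp]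
    refine tendsto_finsetSum _ fun j _ => Tendsto.const_mul _ ?_
    rw [Metric.tendsto_nhds]
    intro e he
    have he' : 0 < e / (2 * a j) := by have := ha j; positivity
    obtain ⟨T, hT⟩ := eventually_atBot.1 (Metric.tendsto_nhds.1 hbot _ he')
    filter_upwards [eventually_le_atBot T] with s hs
    rw [dist_zero_right]
    refine (intervalIntegral.norm_integral_le_of_norm_le_const (C := e / (2 * a j))
      fun u hu => ?_).trans_lt ?_
    · rw [uIoc_of_le (by linarith [ha j])] at hu
      simpa using (hT u (hu.2.trans hs)).le
    · rw [sub_sub_cancel, abs_of_pos (ha j)]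
      have := (ha j).ne'
      field_simp
      linarith
  have h := intervalIntegral_tendsto_integral (μ := volume) hz tendsto_neg_atTop_atBot tendsto_id
  simp only [id, hdiff] at h
  simpa using h.add (hWbot.comp tendsto_neg_atTop_atBot)

/-- With Y the primitive of Z and c = I/μ, the function R(t) = Y(t) - ct solves a renewal equation
whose forcing term tends to 0. Hence R grows sublinearly. -/
theorem tendsto_average_of_renewal (hp : ∀ j, 0 < p j) (hp1 : ∑ j, p j = 1)
    (ha : ∀ j, 0 < a j) (hint : ∀ s t, IntervalIntegrable Z volume s t)
    (hW : Tendsto (fun t => ∑ j, p j * ∫ u in (t - a j)..t, Z u) atTop (𝓝 I)) :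
    Tendsto (fun T : ℝ => (∫ t in (0 : ℝ)..T, Z t) / T) atTop (𝓝 (I / ∑ j, p j * a j)) := by
  set μ := ∑ j, p j * a j with hμ
  have hμ0 : 0 < μ := by
    refine Finset.sum_pos (fun j _ => mul_pos (hp j) (ha j)) ?_
    by_contra hne
    rw [Finset.not_nonempty_iff_eq_empty] at hne
    rw [hne] at hp1
    simp at hp1
  set Y : ℝ → ℝ := fun t => ∫ u in (0 : ℝ)..t, Z u with hY
  have hYc : Continuous Y := intervalIntegral.continuous_primitive (fun s t => hint s t) 0
  set c := I / μ with hc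
  set R : ℝ → ℝ := fun t => Y t - c * t with hR
  have hRrec : ∀ t, R t = ((∑ j, p j * ∫ u in (t - a j)..t, Z u) - I)
      + ∑ j, p j * R (t - a j) := by
    intro t
    have h1 : ∀ j, ∫ u in (t - a j)..t, Z u = Y t - Y (t - a j) := fun j => by
      rw [hY]
      exact (intervalIntegral.integral_interval_sub_left (hint _ _) (hint _ _)).symm
    have h2 : I = c * μ := by rw [hc, div_mul_cancel₀ _ hμ0.ne']
    have h3 : ∑ j, p j * (Y t - Y (t - a j)) + ∑ j, p j * R (t - a j)
        = (∑ j, p j) * (Y t - c * t) + c * μ := by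
      rw [hμ, ← Finset.sum_add_distrib, Finset.sum_mul, Finset.mul_sum, ← Finset.sum_add_distrib]
      refine Finset.sum_congr rfl fun j _ => ?_
      simp only [hR]
      ring
    simp_rw [h1]
    rw [h2]
    rw [hp1, one_mul] at h3
    simp only [hR] at h3 ⊢
    linarith
  obtain ⟨A, hA⟩ : ∃ A : ℝ, ∀ j, a j ≤ A :=
    (eventually_all.2 fun j => eventually_ge_atTop (a j)).exists
  rw [Metric.tendsto_nhds]
  intro e he
  -- An error of e/2 · μ per step is exactly what the line of slope e/2 gains over a p-average of
  -- the steps, so the bound on |R| below is inductive.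
  have heμ : 0 < e / 2 * μ := by positivity
  obtain ⟨T, hT⟩ := eventually_atTop.1 (Metric.tendsto_nhds.1 hW _ heμ)
  obtain ⟨K, hK⟩ := (isCompact_Icc (a := T) (b := T + A)).exists_bound_of_continuousOn
    (f := R) (by rw [hR]; fun_prop)
  have hbound : ∀ t, T ≤ t → |R t| ≤ e / 2 * (t - T) + K := by
    refine forall_of_forall_sub ha (T := T + A) (fun t ht hTt => ?_) (fun t ht ih hTt => ?_)
    · have := hK t ⟨hTt, ht⟩
      rw [Real.norm_eq_abs] at this
      nlinarith
    · have h1 := hT t hTt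
      rw [Real.dist_eq] at h1
      have h2 : |∑ j, p j * R (t - a j)| ≤ ∑ j, p j * (e / 2 * (t - a j - T) + K) := by
        refine (Finset.abs_sum_le_sum_abs _ _).trans (Finset.sum_le_sum fun j _ => ?_)
        rw [abs_mul, abs_of_pos (hp j)]
        exact mul_le_mul_of_nonneg_left (ih j (by linarith [hA j])) (hp j).le
      have h3 : ∑ j, p j * (e / 2 * (t - a j - T) + K)
          = (∑ j, p j) * (e / 2 * (t - T) + K) - e / 2 * μ := by
        rw [hμ, Finset.sum_mul, Finset.mul_sum, ← Finset.sum_sub_distrib]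
        exact Finset.sum_congr rfl fun j _ => by ring
      rw [hp1, one_mul] at h3
      rw [hRrec t]
      refine (abs_add_le _ _).trans ?_
      linarith
  filter_upwards [eventually_gt_atTop 0, eventually_ge_atTop T,
    eventually_gt_atTop ((K - e / 2 * T) / (e / 2))] with t ht0 htT htK
  have h1 := hbound t htT
  rw [div_lt_iff₀ (by positivity)] at htK
  rw [Real.dist_eq, show Y t / t - c = R t / t by simp only [hR]; field_simp, abs_div,
    abs_of_pos ht0, div_lt_iff₀ ht0]
  linarith

/-- Asymptotically Z(t) is a weighted mean of the Z(t - a_j), none of which exceeds S by much. If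
the mean is near S, every term is; iteration reaches all sums of the a_j. -/
theorem tendsto_comp_sub_of_renewal (hp : ∀ j, 0 < p j) (hp1 : ∑ j, p j = 1)
    (hrec : ∀ t, Z t = z t + ∑ j, p j * Z (t - a j)) (hz : Tendsto z atTop (𝓝 0)) {S : ℝ}
    (hS : ∀ e > 0, ∀ᶠ t in atTop, Z t ≤ S + e) {s : ℝ}
    (hs : s ∈ AddSubmonoid.closure (range a)) :
    ∀ l : Filter ℝ, l ≤ atTop → Tendsto Z l (𝓝 S) → Tendsto (fun t => Z (t - s)) l (𝓝 S) := by
  have hsub : ∀ (x : ℝ) (l : Filter ℝ), l ≤ atTop → Tendsto (fun t => t - x) l atTop :=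
    fun x l hl => (tendsto_atTop_add_const_right atTop (-x) tendsto_id).mono_left hl
  induction hs using AddSubmonoid.closure_induction with
  | mem x hx =>
    obtain ⟨j, rfl⟩ := hx
    intro l hl hZl
    rw [tendsto_order]
    constructor
    · intro b hb
      -- Three errors must fit below p_j(S - b): Z(t) > S - e, z(t) < e, and the other terms total
      -- at most (1 - p_j)(S + e).
      set e := p j * (S - b) / 4 with he
      have he0 : 0 < e := by have := hp j; have := sub_pos.2 hb; positivity
      have hup : ∀ᶠ t in l, ∀ k, Z (t - a k) ≤ S + e :=
        eventually_all.2 fun k => (hsub (a k) l hl).eventually (hS e he0)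
      filter_upwards [hup, (tendsto_order.1 hZl).1 (S - e) (by linarith),
        (tendsto_order.1 (hz.mono_left hl)).2 e he0] with t h1 h2 h3
      have h4 := hrec t
      rw [← Finset.add_sum_erase _ _ (Finset.mem_univ j)] at h4 hp1
      have h5 : ∑ k ∈ Finset.univ.erase j, p k * Z (t - a k)
          ≤ ∑ k ∈ Finset.univ.erase j, p k * (S + e) :=
        Finset.sum_le_sum fun k _ => mul_le_mul_of_nonneg_left (h1 k) (hp k).le
      rw [← Finset.sum_mul, show ∑ k ∈ Finset.univ.erase j, p k = 1 - p j by linarith] at h5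
      have h6 : p j * b < p j * Z (t - a j) := by
        have : 0 < p j * e := mul_pos (hp j) he0
        have : p j * (S - b) = 4 * e := by rw [he]; ring
        nlinarith
      exact lt_of_mul_lt_mul_left h6 (hp j).le
    · intro b hb
      filter_upwards [(hsub (a j) l hl).eventually (hS ((b - S) / 2) (by linarith))] with t ht
      linarith
  | zero => simp
  | add x y _ _ ihx ihy =>
    intro l hl hZl
    -- The hypothesis for y is used along the translated filter, which is why the statement
    -- quantifies over `l`.
    have := ihy (l.map fun t => t - x) (hsub x l hl) (by simpa [Tendsto, Function.comp_def] using ihx l hl hZl)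
    rw [tendsto_map'_iff] at this
    refine this.congr fun t => ?_
    simp [sub_sub]

theorem exists_sub_of_mem_closure {S : Set ℝ} {x : ℝ} (hx : x ∈ AddSubgroup.closure S) :
    ∃ s ∈ AddSubmonoid.closure S, ∃ t ∈ AddSubmonoid.closure S, x = s - t := by
  induction hx using AddSubgroup.closure_induction with
  | mem x hx => exact ⟨x, AddSubmonoid.subset_closure hx, 0, zero_mem _, by simp⟩
  | zero => exact ⟨0, zero_mem _, 0, zero_mem _, by simp⟩
  | add x y _ _ hx hy =>
    obtain ⟨s, hs, t, ht, rfl⟩ := hx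
    obtain ⟨s', hs', t', ht', rfl⟩ := hy
    exact ⟨s + s', add_mem hs hs', t + t', add_mem ht ht', by ring⟩
  | neg x _ hx =>
    obtain ⟨s, hs, t, ht, rfl⟩ := hx
    exact ⟨t, ht, s, hs, by ring⟩

/-- A subsemigroup of `ℝ` generating a dense subgroup has finite subsets that are `δ`-dense in
intervals of any given length. -/
theorem exists_finite_net {S : Set ℝ} (hd : Dense (AddSubgroup.closure S : Set ℝ)) {δ : ℝ}
    (hδ : 0 < δ) (A : ℝ) :
    ∃ (T : ℝ) (N : Finset ℝ), (∀ s ∈ N, s ∈ AddSubmonoid.closure S) ∧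
      ∀ u ∈ Icc T (T + A), ∃ s ∈ N, ∃ t ∈ N, s ≤ u ∧ u ≤ t ∧ t - s ≤ δ := by
  obtain ⟨x, hx, hx0, hxδ⟩ := hd.exists_between hδ
  obtain ⟨s₁, hs₁, s₂, hs₂, rfl⟩ := exists_sub_of_mem_closure hx
  set x := s₁ - s₂
  -- With x = s₁ - s₂ in (0, δ), the points n s₂ + k x = k s₁ + (n - k) s₂, 0 ≤ k ≤ n, stay in the
  -- semigroup. They form a progression of gap below δ and length at least A.
  obtain ⟨n, hn⟩ := exists_nat_ge (A / x + 1)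
  have hmem : ∀ k ≤ n, n * s₂ + k * x ∈ AddSubmonoid.closure S := by
    intro k hk
    have : n * s₂ + k * x = k • s₁ + (n - k) • s₂ := by
      rw [nsmul_eq_mul, nsmul_eq_mul, Nat.cast_sub hk]
      ring
    rw [this]
    exact add_mem (nsmul_mem hs₁ _) (nsmul_mem hs₂ _)
  refine ⟨n * s₂, (Finset.range (n + 1)).image fun k : ℕ => n * s₂ + k * x, ?_, ?_⟩
  · intro s hs
    obtain ⟨k, hk, rfl⟩ := Finset.mem_image.1 hs
    exact hmem k (Nat.lt_succ_iff.1 (Finset.mem_range.1 hk))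
  · rintro u ⟨hu1, hu2⟩
    have hnn : 0 ≤ (u - n * s₂) / x := div_nonneg (by linarith) hx0.le
    have h1 := Nat.floor_le hnn
    have h2 := Nat.lt_floor_add_one ((u - n * s₂) / x)
    set k := ⌊(u - n * s₂) / x⌋₊
    have hkn : k + 1 ≤ n := by
      have : (k : ℝ) + 1 ≤ n := by
        refine le_trans ?_ hn
        gcongr
        refine h1.trans ?_
        gcongr
        linarith
      exact_mod_cast this
    rw [le_div_iff₀ hx0] at h1
    rw [div_lt_iff₀ hx0] at h2
    refine ⟨_, Finset.mem_image.2 ⟨k, Finset.mem_range.2 (by omega), rfl⟩, _,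
      Finset.mem_image.2 ⟨k + 1, Finset.mem_range.2 (by omega), rfl⟩, by linarith, ?_, ?_⟩
    · push_cast; linarith
    · push_cast; linarith [show x < δ from hxδ]

/-- The ultrafilter plays the role of a sequence along which the upper limit is attained. -/
theorem exists_ultrafilter_tendsto_limsup {f : ℝ → ℝ} {B b : ℝ} (hB : ∀ t, f t ≤ B)
    (hb : ∀ t, b ≤ f t) :
    (∀ e > 0, ∀ᶠ t in atTop, f t ≤ limsup f atTop + e) ∧
    ∃ U : Ultrafilter ℝ, ↑U ≤ (atTop : Filter ℝ) ∧ Tendsto f U (𝓝 (limsup f atTop)) := by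
  have hbdd : IsBoundedUnder (· ≤ ·) atTop f := isBoundedUnder_of ⟨B, hB⟩
  have hbdd' : IsBoundedUnder (· ≥ ·) atTop f := isBoundedUnder_of ⟨b, hb⟩
  have hup : ∀ e > 0, ∀ᶠ t in atTop, f t < limsup f atTop + e := fun e he =>
    eventually_lt_of_limsup_lt (by linarith) hbdd
  refine ⟨fun e he => (hup e he).mono fun _ h => h.le, ?_⟩
  refine mapClusterPt_iff_ultrafilter.1 (mapClusterPt_iff_frequently.2 fun s hs => ?_)
  obtain ⟨e, he, hes⟩ := Metric.mem_nhds_iff.1 hs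
  have hlow : ∃ᶠ t in atTop, limsup f atTop - e < f t :=
    frequently_lt_of_lt_limsup hbdd'.isCoboundedUnder_le (by linarith)
  refine (hlow.and_eventually (hup e he)).mono fun t ht => hes ?_
  rw [Metric.mem_ball, Real.dist_eq, abs_lt]
  constructor <;> linarith [ht.1, ht.2]

/-- Along an ultrafilter where Z tends to its upper limit S, so does Z(t - s) for each s in a finite
δ-net taken from the semigroup of the a_j. The growth bound `hmono` carries this to every u in the
window, at the cost of a factor e^(αδ). Comparing with the window integrals, which tend to I, gives
μ(S - δ) ≤ e^(αδ) I; let δ → 0. The lower limit is treated in the same way through -Z. -/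
theorem tendsto_of_renewal_of_dense (hp : ∀ j, 0 < p j) (hp1 : ∑ j, p j = 1)
    (hrec : ∀ t, Z t = z t + ∑ j, p j * Z (t - a j)) (ha : ∀ j, 0 < a j)
    (hint : ∀ s t, IntervalIntegrable Z volume s t) (hz : Tendsto z atTop (𝓝 0))
    (hW : Tendsto (fun t => ∑ j, p j * ∫ u in (t - a j)..t, Z u) atTop (𝓝 I))
    (hZ0 : ∀ t, 0 ≤ Z t) {B : ℝ} (hB : ∀ t, Z t ≤ B) {α : ℝ} (hα : 0 ≤ α)
    (hmono : ∀ s t, s ≤ t → Z t ≤ Real.exp (α * (t - s)) * Z s)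
    (hdense : Dense (AddSubgroup.closure (range a) : Set ℝ)) :
    Tendsto Z atTop (𝓝 (I / ∑ j, p j * a j)) := by
  set μ := ∑ j, p j * a j with hμ
  have hμ0 : 0 < μ := by
    refine Finset.sum_pos (fun j _ => mul_pos (hp j) (ha j)) ?_
    by_contra hne
    rw [Finset.not_nonempty_iff_eq_empty] at hne
    rw [hne] at hp1
    simp at hp1
  obtain ⟨A, hA⟩ : ∃ A : ℝ, ∀ j, a j ≤ A :=
    (eventually_all.2 fun j => eventually_ge_atTop (a j)).exists
  have hsub : ∀ (x : ℝ) (l : Filter ℝ), l ≤ atTop → Tendsto (fun t => t - x) l atTop :=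
    fun x l hl => (tendsto_atTop_add_const_right atTop (-x) tendsto_id).mono_left hl
  have hexp : ∀ c : ℝ, Tendsto (fun δ : ℝ => Real.exp (α * δ) * (c + δ)) (𝓝[>] 0) (𝓝 c) := by
    intro c
    have : Continuous fun δ : ℝ => Real.exp (α * δ) * (c + δ) := by fun_prop
    simpa using (this.tendsto 0).mono_left nhdsWithin_le_nhds
  have hexp' : ∀ c : ℝ, Tendsto (fun δ : ℝ => Real.exp (α * δ) * c) (𝓝[>] 0) (𝓝 c) := by
    intro c
    have : Continuous fun δ : ℝ => Real.exp (α * δ) * c := by fun_prop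
    simpa using (this.tendsto 0).mono_left nhdsWithin_le_nhds
  have hpres : ∀ c : ℝ, ∑ j, p j * (a j * c) = μ * c := fun c => by
    rw [hμ, Finset.sum_mul]
    exact Finset.sum_congr rfl fun j _ => by ring
  -- upper limit
  have hupper : limsup Z atTop ≤ I / μ := by
    obtain ⟨hS, U, hU, hUZ⟩ := exists_ultrafilter_tendsto_limsup hB hZ0
    set S := limsup Z atTop
    have key : ∀ δ > 0, μ * (S - δ) ≤ Real.exp (α * δ) * I := by
      intro δ hδ
      obtain ⟨T, N, hN, hnet⟩ := exists_finite_net hdense hδ A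
      have hev : ∀ᶠ t in (U : Filter ℝ), ∀ s ∈ N, S - δ < Z (t - s) :=
        (Finset.eventually_all N).2 fun s hs => (tendsto_order.1
          (tendsto_comp_sub_of_renewal hp hp1 hrec hz hS (hN s hs) U hU hUZ)).1 _ (by linarith)
      refine ge_of_tendsto ((hW.comp (hsub T U hU)).const_mul _) ?_
      filter_upwards [hev] with t ht
      simp only [Function.comp_apply]
      rw [← hpres, Finset.mul_sum]
      refine Finset.sum_le_sum fun j _ => ?_
      rw [mul_left_comm (Real.exp (α * δ))]
      refine mul_le_mul_of_nonneg_left ?_ (hp j).le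
      rw [← intervalIntegral.integral_const_mul]
      have hc : a j * (S - δ) = ∫ u in (t - T - a j)..(t - T), (S - δ) := by
        rw [intervalIntegral.integral_const, sub_sub_cancel, smul_eq_mul]
      rw [hc]
      refine intervalIntegral.integral_mono_on (by linarith [ha j]) (by simp)
        ((hint _ _).const_mul _) fun u hu => ?_
      -- Here the net point with t - s just to the right of u bounds Z(u) from below; the
      -- lower-limit argument uses the one with t - s' just to its left.
      obtain ⟨s, hs, s', -, h1, h2, h3⟩ := hnet (t - u)
        ⟨by linarith [hu.2], by linarith [hu.1, hA j]⟩
      refine (ht s hs).le.trans ((hmono u (t - s) (by linarith)).trans ?_)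
      refine mul_le_mul_of_nonneg_right (Real.exp_le_exp.2 ?_) (hZ0 u)
      exact mul_le_mul_of_nonneg_left (by linarith) hα
    rw [le_div_iff₀ hμ0, mul_comm]
    refine le_of_tendsto_of_tendsto (b := 𝓝[>] (0 : ℝ)) (f := fun δ => μ * (S - δ)) ?_ (hexp' I)
      (eventually_nhdsWithin_of_forall key)
    have : Continuous fun δ : ℝ => μ * (S - δ) := by fun_prop
    simpa using (this.tendsto 0).mono_left nhdsWithin_le_nhds
  -- lower limit
  have hlower : I / μ ≤ -limsup (fun t => -Z t) atTop := by
    have hrec' : ∀ t, -Z t = -z t + ∑ j, p j * -Z (t - a j) := fun t => by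
      simp only [mul_neg, Finset.sum_neg_distrib]
      linarith [hrec t]
    have hz' : Tendsto (fun t => -z t) atTop (𝓝 0) := by simpa using hz.neg
    obtain ⟨hS, U, hU, hUZ⟩ := exists_ultrafilter_tendsto_limsup (f := fun t => -Z t)
      (B := 0) (b := -B) (fun t => by linarith [hZ0 t]) (fun t => by linarith [hB t])
    -- From here on S denotes the lower limit of Z.
    obtain ⟨S, hSdef⟩ : ∃ S, limsup (fun t => -Z t) atTop = -S := ⟨_, (neg_neg _).symm⟩
    rw [hSdef] at hS hUZ
    rw [hSdef, neg_neg]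
    have key : ∀ δ > 0, I ≤ μ * (Real.exp (α * δ) * (S + δ)) := by
      intro δ hδ
      obtain ⟨T, N, hN, hnet⟩ := exists_finite_net hdense hδ A
      have hev : ∀ᶠ t in (U : Filter ℝ), ∀ s ∈ N, -S - δ < -Z (t - s) :=
        (Finset.eventually_all N).2 fun s hs => (tendsto_order.1
          (tendsto_comp_sub_of_renewal hp hp1 hrec' hz' hS (hN s hs) U hU hUZ)).1 _ (by linarith)
      refine le_of_tendsto (hW.comp (hsub T U hU)) ?_
      filter_upwards [hev] with t ht
      simp only [Function.comp_apply]
      rw [← hpres]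
      refine Finset.sum_le_sum fun j _ => ?_
      refine mul_le_mul_of_nonneg_left ?_ (hp j).le
      have hc : a j * (Real.exp (α * δ) * (S + δ))
          = ∫ u in (t - T - a j)..(t - T), (Real.exp (α * δ) * (S + δ)) := by
        rw [intervalIntegral.integral_const, sub_sub_cancel, smul_eq_mul]
      rw [hc]
      refine intervalIntegral.integral_mono_on (by linarith [ha j]) (hint _ _) (by simp)
        fun u hu => ?_
      obtain ⟨s, -, s', hs', h1, h2, h3⟩ := hnet (t - u)
        ⟨by linarith [hu.2], by linarith [hu.1, hA j]⟩
      refine (hmono (t - s') u (by linarith)).trans ?_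
      have h4 := ht s' hs'
      exact mul_le_mul (Real.exp_le_exp.2 (mul_le_mul_of_nonneg_left (by linarith) hα))
        (by linarith) (hZ0 _) (Real.exp_pos _).le
    rw [div_le_iff₀ hμ0, mul_comm]
    exact ge_of_tendsto ((hexp S).const_mul μ) (eventually_nhdsWithin_of_forall key)
  have hS₁ := (exists_ultrafilter_tendsto_limsup hB hZ0).1
  have hS₂ := (exists_ultrafilter_tendsto_limsup (f := fun t => -Z t)
    (B := 0) (b := -B) (fun t => by linarith [hZ0 t]) (fun t => by linarith [hB t])).1
  rw [Metric.tendsto_nhds]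
  intro e he
  filter_upwards [hS₁ (e / 2) (by positivity), hS₂ (e / 2) (by positivity)] with t h1 h2
  rw [Real.dist_eq, abs_lt]
  constructor <;> linarith

/-- If a combination of translates of `Z` solves the homogeneous renewal equation on the lattice
`ℤη` and `Z` vanishes at `-∞`, the combination vanishes on the lattice. -/
theorem eq_zero_of_homogeneous_renewal (hp : ∀ j, 0 < p j) (hp1 : ∑ j, p j = 1)
    (ha : ∀ j, 0 < a j) {H : AddSubgroup ℝ} (haH : ∀ j, a j ∈ H) {U : ℝ → ℝ}
    (hU : ∀ t ∈ H, U t = ∑ j, p j * U (t - a j)) (hbot : Tendsto U atBot (𝓝 0)) :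
    ∀ t ∈ H, U t = 0 := by
  intro t ht
  rw [← abs_eq_zero]
  refine le_antisymm (le_of_forall_pos_le_add fun e he => ?_) (abs_nonneg _)
  rw [zero_add]
  obtain ⟨T, hT⟩ := eventually_atBot.1 (Metric.tendsto_nhds.1 hbot e he)
  refine forall_of_forall_sub (P := fun t => t ∈ H → |U t| ≤ e) ha (T := T)
    (fun t h _ => ?_) (fun t _ ih htH => ?_) t ht
  · simpa using (hT t h).le
  · rw [hU t htH]
    refine (Finset.abs_sum_le_sum_abs _ _).trans ?_
    calc ∑ j, |p j * U (t - a j)| ≤ ∑ j, p j * e := by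
          refine Finset.sum_le_sum fun j _ => ?_
          rw [abs_mul, abs_of_pos (hp j)]
          exact mul_le_mul_of_nonneg_left (ih j (sub_mem htH (haH j))) (hp j).le
      _ = e := by rw [← Finset.sum_mul, hp1, one_mul]

end Renewal

/-! ### The Moran equation and growth bounds -/

section Moran

variable {d J : ℕ} {r : Fin J → ℝ} {f h : ℝ → ℝ} {V A α : ℝ}

/-- Intermediate value theorem: the sum is J > 1 at exponent 0 and less than 1 at exponent d. -/
theorem exists_moran_exponent (hJ : 2 ≤ J) (hr : ∀ j, 0 < r j) (hlt : ∑ j, r j ^ d < 1) :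
    ∃ D : ℝ, 0 < D ∧ D < d ∧ ∑ j, r j ^ D = 1 := by
  have hc : Continuous fun s : ℝ => ∑ j, r j ^ s :=
    continuous_finsetSum _ fun j _ => Real.continuous_const_rpow (hr j).ne'
  have h0 : (1 : ℝ) < ∑ j, r j ^ (0 : ℝ) := by
    simp only [Real.rpow_zero, Finset.sum_const, Finset.card_univ, Fintype.card_fin, nsmul_eq_mul,
      mul_one]
    exact_mod_cast hJ
  have h1 : ∑ j, r j ^ (d : ℝ) < 1 := by simpa only [Real.rpow_natCast] using hlt
  obtain ⟨D, hD, hDe⟩ := intermediate_value_Ioo' (Nat.cast_nonneg d) hc.continuousOn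
    (show (1 : ℝ) ∈ Ioo _ _ from ⟨h1, h0⟩)
  exact ⟨D, hD.1, hD.2, hDe⟩

theorem sum_rpow_lt (hJ : 2 ≤ J) (hr : ∀ j, 0 < r j) (hr1 : ∀ j, r j < 1) {s t : ℝ}
    (hst : s < t) : ∑ j, r j ^ t < ∑ j, r j ^ s :=
  Finset.sum_lt_sum_of_nonempty ⟨⟨0, by omega⟩, Finset.mem_univ _⟩ fun j _ =>
    Real.rpow_lt_rpow_of_exponent_gt (hr j) (hr1 j) hst

/-- Induction along the divisions by the ratios `r j`. -/
theorem forall_pos_of_forall_div (hr : ∀ j, 0 < r j) (hr1 : ∀ j, r j < 1) {P : ℝ → Prop}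
    {c : ℝ} (hc : 0 < c) (base : ∀ ε, c ≤ ε → P ε)
    (step : ∀ ε, 0 < ε → ε < c → (∀ j, P (ε / r j)) → P ε) {ε : ℝ} (hε : 0 < ε) : P ε := by
  have := forall_of_forall_sub (a := fun j => -Real.log (r j)) (T := -Real.log c)
    (P := fun t => P (Real.exp (-t))) (fun j => neg_pos.2 (Real.log_neg (hr j) (hr1 j)))
    (fun t ht => base _ ((Real.log_le_iff_le_exp hc).1 (by linarith)))
    (fun t ht ih => step _ (Real.exp_pos _) ((Real.lt_log_iff_exp_lt hc).1 (by linarith))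
      fun j => by
        have h1 := ih j
        rwa [show -(t - -Real.log (r j)) = -t - Real.log (r j) by ring, Real.exp_sub,
          Real.exp_log (hr j)] at h1) (-Real.log ε)
  simpa [Real.exp_log hε] using this

theorem pow_mul_div_rpow {x ε : ℝ} (hx : 0 < x) (hε : 0 < ε) (d : ℕ) (β : ℝ) :
    x ^ d * (ε / x) ^ β = x ^ ((d : ℝ) - β) * ε ^ β := by
  rw [Real.div_rpow hε.le hx.le, Real.rpow_sub hx, Real.rpow_natCast]
  ring

/-- The recursion contracts the constant by ρ = Σ r_j^(d-β) < 1, so any B with A + Bρ ≤ B survives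
the induction. -/
theorem exists_le_rpow_of_sum_lt_one (hr : ∀ j, 0 < r j) (hr1 : ∀ j, r j < 1)
    (hrec : ∀ ε, f ε = h ε + ∑ j, r j ^ d * f (ε / r j)) (hV0 : 0 ≤ V) (hV : ∀ ε, f ε ≤ V)
    {β : ℝ} (hβ : 0 ≤ β) (hh : ∀ ε, 0 < ε → h ε ≤ A * ε ^ β)
    (hlt : ∑ j, r j ^ ((d : ℝ) - β) < 1) : ∃ B : ℝ, ∀ ε, 0 < ε → f ε ≤ B * ε ^ β := by
  set ρ := ∑ j, r j ^ ((d : ℝ) - β) with hρ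
  set B := max V (A / (1 - ρ)) with hB
  refine ⟨B, fun ε hε => ?_⟩
  refine forall_pos_of_forall_div (P := fun ε => f ε ≤ B * ε ^ β) hr hr1 one_pos
    (fun ε h1 => ?_) (fun ε h0 _ ih => ?_) hε
  · calc f ε ≤ V := hV ε
      _ ≤ B := le_max_left _ _
      _ ≤ B * ε ^ β := le_mul_of_one_le_right (hV0.trans (le_max_left _ _))
          (Real.one_le_rpow h1 hβ)
  · have hAB : A + B * ρ ≤ B := by
      have : A / (1 - ρ) ≤ B := le_max_right _ _
      rw [div_le_iff₀ (by linarith)] at this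
      linarith
    have hpos := Real.rpow_pos_of_pos h0 β
    have hsum : ∑ j, r j ^ d * f (ε / r j) ≤ B * ρ * ε ^ β := by
      rw [hρ, Finset.mul_sum, Finset.sum_mul]
      refine Finset.sum_le_sum fun j _ => ?_
      refine (mul_le_mul_of_nonneg_left (ih j) (pow_nonneg (hr j).le d)).trans (le_of_eq ?_)
      rw [mul_left_comm, pow_mul_div_rpow (hr j) h0]
      ring
    rw [hrec]
    nlinarith [hh ε h0]

/-- At the critical exponent nothing contracts, so the induction runs on the stronger bound B ε^α -
K ε. The recursion multiplies the correction by σ = Σ r_j^(d-1) > 1, and K = A/(σ - 1) makes the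
gain K(σ - 1)ε absorb the forcing term A ε. -/
theorem exists_le_rpow_of_sum_eq_one (hr : ∀ j, 0 < r j) (hr1 : ∀ j, r j < 1)
    (hrec : ∀ ε, f ε = h ε + ∑ j, r j ^ d * f (ε / r j)) (hV0 : 0 ≤ V) (hV : ∀ ε, f ε ≤ V)
    (hα0 : 0 ≤ α) (hα1 : α ≤ 1) (hA : 0 ≤ A) (hh : ∀ ε, 0 < ε → h ε ≤ A * ε)
    (h1 : ∑ j, r j ^ ((d : ℝ) - α) = 1) (hgt : 1 < ∑ j, r j ^ ((d : ℝ) - 1)) :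
    ∃ B : ℝ, 0 ≤ B ∧ ∀ ε, 0 < ε → f ε ≤ B * ε ^ α := by
  set σ := ∑ j, r j ^ ((d : ℝ) - 1) with hσ
  set K := A / (σ - 1) with hK
  have hK0 : 0 ≤ K := div_nonneg hA (by linarith)
  obtain ⟨ρ, hρr, hρ⟩ : ∃ ρ : ℝ, (∀ j, ρ < r j) ∧ ρ ∈ Ioi (0 : ℝ) :=
    ((eventually_all.2 fun j => nhdsWithin_le_nhds (eventually_lt_nhds (hr j))).and
      (self_mem_nhdsWithin (a := (0 : ℝ)) (s := Ioi 0))).exists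
  rw [mem_Ioi] at hρ
  have hρα := Real.rpow_pos_of_pos hρ α
  set B := K + V / ρ ^ α with hB
  have hVB : 0 ≤ V / ρ ^ α := by positivity
  have hsmall : ∀ ε, 0 < ε → ε ≤ 1 → f ε ≤ B * ε ^ α - K * ε := by
    intro ε hε
    refine forall_pos_of_forall_div (P := fun ε => ε ≤ 1 → f ε ≤ B * ε ^ α - K * ε) hr hr1 hρ
      (fun ε hρε hε1 => ?_) (fun ε h0 hερ ih _ => ?_) hε
    · have hε0 := hρ.trans_le hρε
      have h2 : ε ≤ ε ^ α := by
        simpa using Real.rpow_le_rpow_of_exponent_ge hε0 hε1 hα1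
      have h3 : V ≤ V / ρ ^ α * ε ^ α := by
        rw [div_mul_eq_mul_div, le_div_iff₀ hρα]
        exact mul_le_mul_of_nonneg_left (Real.rpow_le_rpow hρ.le hρε hα0) hV0
      have h4 := mul_le_mul_of_nonneg_left h2 hK0
      rw [hB, add_mul]
      linarith [hV ε]
    · have hsum : ∑ j, r j ^ d * f (ε / r j) ≤ B * ε ^ α - K * ε * σ := by
        rw [show B * ε ^ α = (∑ j, r j ^ ((d : ℝ) - α)) * (B * ε ^ α) by rw [h1, one_mul], hσ,
          Finset.sum_mul, Finset.mul_sum, ← Finset.sum_sub_distrib]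
        refine Finset.sum_le_sum fun j _ => ?_
        refine (mul_le_mul_of_nonneg_left (ih j ?_) (pow_nonneg (hr j).le d)).trans
          (le_of_eq ?_)
        · rw [div_le_one (hr j)]
          exact hερ.le.trans (hρr j).le
        · have e1 := pow_mul_div_rpow (hr j) h0 d α
          have e2 := pow_mul_div_rpow (hr j) h0 d 1
          rw [Real.rpow_one, Real.rpow_one] at e2
          linear_combination B * e1 - K * e2
      have hKσ : A = K * (σ - 1) := by rw [hK, div_mul_cancel₀ _ (by linarith)]
      rw [hrec]
      have := hh ε h0
      rw [hKσ] at this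
      linarith
  refine ⟨B + V, by positivity, fun ε hε => ?_⟩
  have hpos := Real.rpow_pos_of_pos hε α
  rcases le_or_gt ε 1 with h2 | h2
  · have := hsmall ε hε h2
    nlinarith [mul_nonneg hK0 hε.le, mul_nonneg hV0 hpos.le]
  · have h3 := Real.one_le_rpow h2.le hα0
    have h4 : 0 ≤ B * ε ^ α := by positivity
    nlinarith [hV ε, mul_le_mul_of_nonneg_left h3 hV0]

/-- The forcing term is nonnegative, so a critical power bound valid on [ρ, 1] propagates to all
smaller scales; on [ρ, 1] monotonicity gives the constant f(ρ). -/
theorem exists_rpow_le_of_sum_eq_one (hr : ∀ j, 0 < r j) (hr1 : ∀ j, r j < 1)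
    (hrec : ∀ ε, f ε = h ε + ∑ j, r j ^ d * f (ε / r j)) (hf : Monotone f)
    (hf0 : ∀ ε, 0 < ε → 0 < f ε) (hα0 : 0 ≤ α) (hh : ∀ ε, 0 < ε → 0 ≤ h ε)
    (h1 : ∑ j, r j ^ ((d : ℝ) - α) = 1) :
    ∃ c : ℝ, 0 < c ∧ ∀ ε, 0 < ε → ε ≤ 1 → c * ε ^ α ≤ f ε := by
  obtain ⟨ρ, hρr, hρ⟩ : ∃ ρ : ℝ, (∀ j, ρ < r j) ∧ ρ ∈ Ioi (0 : ℝ) :=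
    ((eventually_all.2 fun j => nhdsWithin_le_nhds (eventually_lt_nhds (hr j))).and
      (self_mem_nhdsWithin (a := (0 : ℝ)) (s := Ioi 0))).exists
  rw [mem_Ioi] at hρ
  refine ⟨f ρ, hf0 ρ hρ, fun ε hε => ?_⟩
  refine forall_pos_of_forall_div (P := fun ε => ε ≤ 1 → f ρ * ε ^ α ≤ f ε) hr hr1 hρ
    (fun ε hρε hε1 => ?_) (fun ε h0 hερ ih _ => ?_) hε
  · exact (mul_le_of_le_one_right (hf0 ρ hρ).le
      (Real.rpow_le_one (hρ.le.trans hρε) hε1 hα0)).trans (hf hρε)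
  · have hsum : f ρ * ε ^ α ≤ ∑ j, r j ^ d * f (ε / r j) := by
      rw [show f ρ * ε ^ α = (∑ j, r j ^ ((d : ℝ) - α)) * (f ρ * ε ^ α) by rw [h1, one_mul],
        Finset.sum_mul]
      refine Finset.sum_le_sum fun j _ => ?_
      refine le_trans (le_of_eq ?_) (mul_le_mul_of_nonneg_left (ih j ?_) (pow_nonneg (hr j).le d))
      · linear_combination (-f ρ) * pow_mul_div_rpow (hr j) h0 d α
      · rw [div_le_one (hr j)]
        exact hερ.le.trans (hρr j).le
    rw [hrec ε]
    linarith [hh ε h0]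

end Moran

/-! ### The Minkowski dimension as the Moran exponent. -/

section Dimension

variable {d J : ℕ} {r : Fin J → ℝ} {f h : ℝ → ℝ} {V A K D₀ : ℝ} {F : Set (Euc d)}

/-- Every t strictly between max(D₀, d-1) and d is admissible, the term d-1 coming from the O(ε)
contributions. So the dimension is at most that maximum, and `hdim` excludes d-1. Conversely, the
lower bound c ε^(d-D₀) rules out every t < D₀. -/
theorem minkowskiDim_eq_of_moran (hJ : 2 ≤ J) (hr : ∀ j, 0 < r j) (hr1 : ∀ j, r j < 1)
    (hrec : ∀ ε, f ε = h ε + ∑ j, r j ^ d * f (ε / r j)) (hf : Monotone f)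
    (hf0 : ∀ ε, 0 < ε → 0 < f ε) (hV : ∀ ε, f ε ≤ V) (hh0 : ∀ ε, 0 < ε → 0 ≤ h ε)
    (hA : 0 ≤ A) (hh : ∀ ε, 0 < ε → h ε ≤ A * ε)
    (hlow : ∀ ε, f ε ≤ tubeVolume F ε) (hK : 0 ≤ K)
    (hup : ∀ ε, 0 ≤ ε → ε ≤ 1 → tubeVolume F ε ≤ f ε + K * ε)
    (hD₀ : 0 < D₀) (hD₀d : D₀ < d) (hmoran : ∑ j, r j ^ D₀ = 1)
    (hdim : (d : ℝ) - 1 < minkowskiDim F) : minkowskiDim F = D₀ := by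
  have hV0 : 0 ≤ V := (hf0 1 one_pos).le.trans (hV 1)
  have hev : ∀ᶠ ε : ℝ in 𝓝[>] 0, 0 < ε ∧ ε ≤ 1 := by
    filter_upwards [Ioc_mem_nhdsGT (zero_lt_one (α := ℝ))] with ε hε using hε
  have hmem : ∀ t : ℝ, max D₀ ((d : ℝ) - 1) < t → t < d → t ∈ {t : ℝ | 0 ≤ t ∧
      (fun ε => tubeVolume F ε) =O[𝓝[>] 0] fun ε : ℝ => ε ^ ((d : ℝ) - t)} := by
    intro t ht htd
    rw [max_lt_iff] at ht
    have hle1 : (d : ℝ) - t ≤ 1 := by linarith [ht.2]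
    -- The summand A handles ε ≤ 1, where ε ≤ ε^(d-t); V handles ε > 1, where h ≤ f ≤ V.
    obtain ⟨B, hB⟩ := exists_le_rpow_of_sum_lt_one (V := V) (A := A + V) (β := d - t) hr hr1 hrec
      hV0 hV (by linarith) (fun ε hε => by
        rcases le_or_gt ε 1 with h1 | h1
        · have h2 : ε ≤ ε ^ ((d : ℝ) - t) := by
            simpa using Real.rpow_le_rpow_of_exponent_ge hε h1 hle1
          nlinarith [hh ε hε, mul_nonneg hV0 (hε.le.trans h2), mul_le_mul_of_nonneg_left h2 hA]
        · have h2 : 1 ≤ ε ^ ((d : ℝ) - t) := Real.one_le_rpow h1.le (by linarith)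
          have h3 : h ε ≤ V := by
            have : 0 ≤ ∑ j, r j ^ d * f (ε / r j) := Finset.sum_nonneg fun j _ =>
              mul_nonneg (pow_nonneg (hr j).le d) (hf0 _ (div_pos hε (hr j))).le
            linarith [hrec ε, hV ε]
          nlinarith [mul_nonneg hA (zero_le_one.trans h2), mul_le_mul_of_nonneg_left h2 hV0])
      (by rw [sub_sub_cancel, ← hmoran]; exact sum_rpow_lt hJ hr hr1 ht.1)
    refine ⟨by linarith [ht.1], Asymptotics.IsBigO.of_bound (B + K) ?_⟩
    filter_upwards [hev] with ε hε
    have h2 : ε ≤ ε ^ ((d : ℝ) - t) := by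
      simpa using Real.rpow_le_rpow_of_exponent_ge hε.1 hε.2 hle1
    rw [Real.norm_of_nonneg ((hf0 ε hε.1).le.trans (hlow ε)),
      Real.norm_of_nonneg (hε.1.le.trans h2)]
    nlinarith [hup ε hε.1.le hε.2, hB ε hε.1, mul_le_mul_of_nonneg_left h2 hK]
  have hbdd : BddBelow {t : ℝ | 0 ≤ t ∧
      (fun ε => tubeVolume F ε) =O[𝓝[>] 0] fun ε : ℝ => ε ^ ((d : ℝ) - t)} :=
    ⟨0, fun t ht => ht.1⟩
  have hmaxd : max D₀ ((d : ℝ) - 1) < d := max_lt hD₀d (by linarith)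
  have hle : minkowskiDim F ≤ max D₀ ((d : ℝ) - 1) := by
    by_contra! hcon
    obtain ⟨t, ht1, ht2⟩ := exists_between (lt_min hcon hmaxd)
    exact absurd (csInf_le hbdd (hmem t ht1 (ht2.trans_le (min_le_right _ _))))
      (not_le.2 (ht2.trans_le (min_le_left _ _)))
  have hle' : minkowskiDim F ≤ D₀ := by
    rcases le_max_iff.1 hle with h1 | h1
    · exact h1
    · linarith
  refine le_antisymm hle' ?_
  obtain ⟨t₀, ht₀, ht₀'⟩ := exists_between hmaxd
  refine le_csInf ⟨t₀, hmem t₀ ht₀ ht₀'⟩ fun t ht => ?_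
  by_contra! hlt
  obtain ⟨c, hc, hcf⟩ := exists_rpow_le_of_sum_eq_one (α := d - D₀) hr hr1 hrec hf hf0
    (by linarith) hh0 (by rwa [sub_sub_cancel])
  obtain ⟨B, hB⟩ := ht.2.bound
  have hinf : Tendsto (fun ε : ℝ => ε ^ (t - D₀)) (𝓝[>] 0) atTop :=
    tendsto_rpow_neg_nhdsGT_zero (by linarith)
  obtain ⟨ε, ⟨⟨hε0, hε1⟩, hεB⟩, hεlt⟩ :=
    ((hev.and hB).and (hinf.eventually_gt_atTop (B / c))).exists
  rw [Real.norm_of_nonneg ((hf0 ε hε0).le.trans (hlow ε)),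
    Real.norm_of_nonneg (Real.rpow_pos_of_pos hε0 _).le] at hεB
  have h1 := (hcf ε hε0 hε1).trans ((hlow ε).trans hεB)
  rw [div_lt_iff₀ hc] at hεlt
  have h2 : ε ^ ((d : ℝ) - D₀) = ε ^ (t - D₀) * ε ^ ((d : ℝ) - t) := by
    rw [← Real.rpow_add hε0]; ring_nf
  have h3 := Real.rpow_pos_of_pos hε0 ((d : ℝ) - t)
  rw [h2] at h1
  nlinarith

theorem tendsto_sub_log_div_log {v : ℝ → ℝ} {α b c B : ℝ} (hc : 0 < c)
    (hlow : ∀ᶠ ε : ℝ in 𝓝[>] 0, c * ε ^ α ≤ v ε) (hup : ∀ᶠ ε : ℝ in 𝓝[>] 0, v ε ≤ B * ε ^ α) :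
    Tendsto (fun ε : ℝ => b - Real.log (v ε) / Real.log ε) (𝓝[>] 0) (𝓝 (b - α)) := by
  refine Tendsto.const_sub b ?_
  have hlog : Tendsto (fun ε : ℝ => (Real.log ε)⁻¹) (𝓝[>] 0) (𝓝 0) :=
    tendsto_inv_atBot_zero.comp Real.tendsto_log_nhdsGT_zero
  have hsq : Tendsto (fun ε : ℝ => Real.log (v ε) / Real.log ε - α) (𝓝[>] 0) (𝓝 0) := by
    have hM : Tendsto (fun ε : ℝ => (|Real.log c| + |Real.log B|) * ‖(Real.log ε)⁻¹‖)
        (𝓝[>] 0) (𝓝 0) := by simpa using hlog.norm.const_mul _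
    refine squeeze_zero_norm' ?_ hM
    filter_upwards [hlow, hup, Ioo_mem_nhdsGT (zero_lt_one (α := ℝ))] with ε h1 h2 hε
    have hpos := Real.rpow_pos_of_pos hε.1 α
    have hv : 0 < v ε := (mul_pos hc hpos).trans_le h1
    have hB : 0 < B := pos_of_mul_pos_left (hv.trans_le h2) hpos.le
    have h3 := Real.log_le_log (mul_pos hc hpos) h1
    have h4 := Real.log_le_log hv h2
    rw [Real.log_mul hc.ne' hpos.ne', Real.log_rpow hε.1] at h3
    rw [Real.log_mul hB.ne' hpos.ne', Real.log_rpow hε.1] at h4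
    have hlne : Real.log ε ≠ 0 := (Real.log_neg hε.1 hε.2).ne
    rw [show Real.log (v ε) / Real.log ε - α
      = (Real.log (v ε) - α * Real.log ε) * (Real.log ε)⁻¹ by field_simp, norm_mul]
    refine mul_le_mul_of_nonneg_right ?_ (norm_nonneg _)
    rw [Real.norm_eq_abs, abs_le]
    constructor
    · linarith [neg_abs_le (Real.log c), abs_nonneg (Real.log B)]
    · linarith [le_abs_self (Real.log B), abs_nonneg (Real.log c)]
  simpa using hsq.add_const α

end Dimension

/-! ### Logarithmic rescaling -/

/-- The function `ε ↦ ε ^ (-α) k(ε)` in the variable `t = -log ε`. -/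
noncomputable def logRescale (α : ℝ) (k : ℝ → ℝ) (t : ℝ) : ℝ :=
  Real.exp (α * t) * k (Real.exp (-t))

section LogRescale

variable {d J : ℕ} {r : Fin J → ℝ} {α D g v : ℝ} {f h k : ℝ → ℝ} {κ : ℕ → ℝ}

theorem logRescale_neg_log {ε : ℝ} (hε : 0 < ε) :
    logRescale α k (-Real.log ε) = k ε * ε ^ (-α) := by
  rw [logRescale, neg_neg, Real.exp_log hε, Real.rpow_def_of_pos hε, mul_comm]
  ring_nf

theorem tendsto_logRescale_iff {L : ℝ} :
    Tendsto (logRescale α k) atTop (𝓝 L) ↔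
      Tendsto (fun ε : ℝ => k ε * ε ^ (-α)) (𝓝[>] 0) (𝓝 L) := by
  have h1 : Tendsto (fun ε : ℝ => -Real.log ε) (𝓝[>] 0) atTop :=
    tendsto_neg_atBot_atTop.comp Real.tendsto_log_nhdsGT_zero
  have h2 : Tendsto (fun t : ℝ => Real.exp (-t)) atTop (𝓝[>] 0) :=
    tendsto_nhdsWithin_iff.2 ⟨Real.tendsto_exp_neg_atTop_nhds_zero,
      Eventually.of_forall fun t => Real.exp_pos _⟩
  constructor
  · intro h
    refine (h.comp h1).congr' ?_
    filter_upwards [self_mem_nhdsWithin] with ε hε using logRescale_neg_log hε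
  · intro h
    refine (h.comp h2).congr fun t => ?_
    have := logRescale_neg_log (α := α) (k := k) (Real.exp_pos (-t))
    rw [Real.log_exp, neg_neg] at this
    exact this.symm

theorem logRescale_renewal (hr : ∀ j, 0 < r j)
    (hrec : ∀ ε, f ε = h ε + ∑ j, r j ^ d * f (ε / r j)) (t : ℝ) :
    logRescale (d - D) f t = logRescale (d - D) h t +
      ∑ j, r j ^ D * logRescale (d - D) f (t - Real.log (r j)⁻¹) := by
  simp only [logRescale]
  rw [hrec, mul_add, Finset.mul_sum]
  congr 1
  refine Finset.sum_congr rfl fun j _ => ?_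
  have e1 : Real.exp (-(t - Real.log (r j)⁻¹)) = Real.exp (-t) / r j := by
    rw [Real.log_inv, show -(t - -Real.log (r j)) = -t - Real.log (r j) by ring, Real.exp_sub,
      Real.exp_log (hr j)]
  have e2 : r j ^ D * Real.exp (((d : ℝ) - D) * (t - Real.log (r j)⁻¹))
      = Real.exp (((d : ℝ) - D) * t) * r j ^ d := by
    rw [← Real.rpow_natCast (r j) d, Real.rpow_def_of_pos (hr j), Real.rpow_def_of_pos (hr j),
      ← Real.exp_add, ← Real.exp_add, Real.log_inv]
    congr 1
    ring
  rw [e1, ← mul_assoc, ← mul_assoc, e2]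

theorem intervalIntegrable_logRescale (hk : Monotone k) (s t : ℝ) :
    IntervalIntegrable (logRescale α k) volume s t := by
  have h1 : Antitone fun t : ℝ => k (Real.exp (-t)) := fun x y hxy =>
    hk (Real.exp_le_exp.2 (neg_le_neg hxy))
  exact (h1.intervalIntegrable (a := s) (b := t)).continuousOn_mul
    (Continuous.continuousOn (by fun_prop))

/-- One-sided regularity that replaces uniform continuity when passing from a net to a full
interval. -/
theorem logRescale_le_exp_mul (hk : Monotone k) {s t : ℝ} (hst : s ≤ t) :
    logRescale α k t ≤ Real.exp (α * (t - s)) * logRescale α k s := by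
  rw [logRescale, logRescale, ← mul_assoc, ← Real.exp_add, ← mul_add, sub_add_cancel]
  exact mul_le_mul_of_nonneg_left (hk (Real.exp_le_exp.2 (neg_le_neg hst))) (Real.exp_pos _).le

theorem tendsto_logRescale_atBot {V : ℝ} (hα : 0 < α) (h0 : ∀ ε, 0 ≤ k ε) (hV : ∀ ε, k ε ≤ V) :
    Tendsto (logRescale α k) atBot (𝓝 0) := by
  have h1 : Tendsto (fun t : ℝ => Real.exp (α * t) * V) atBot (𝓝 0) := by
    simpa using (Real.tendsto_exp_atBot.comp
      (tendsto_id.const_mul_atBot hα)).mul_const V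
  exact squeeze_zero (fun t => mul_nonneg (Real.exp_pos _).le (h0 _))
    (fun t => mul_le_mul_of_nonneg_left (hV _) (Real.exp_pos _).le) h1

theorem tendsto_logRescale_atTop {A : ℝ} (hα : α < 1) (h0 : ∀ᶠ ε in 𝓝[>] 0, 0 ≤ k ε)
    (hA : ∀ᶠ ε in 𝓝[>] 0, k ε ≤ A * ε) :
    Tendsto (logRescale α k) atTop (𝓝 0) := by
  rw [tendsto_logRescale_iff]
  have h1 : Tendsto (fun ε : ℝ => A * ε ^ (1 - α)) (𝓝[>] 0) (𝓝 0) := by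
    have h2 : Tendsto (fun ε : ℝ => ε ^ (1 - α)) (𝓝[>] 0) (𝓝 0) := by
      have := (Real.continuousAt_rpow_const 0 (1 - α) (Or.inr (by linarith))).tendsto
      rw [Real.zero_rpow (by linarith)] at this
      exact this.mono_left nhdsWithin_le_nhds
    simpa using h2.const_mul A
  refine squeeze_zero' ?_ ?_ h1
  · filter_upwards [h0, self_mem_nhdsWithin] with ε h hε
    exact mul_nonneg h (Real.rpow_pos_of_pos hε _).le
  · filter_upwards [hA, self_mem_nhdsWithin] with ε h hε
    have hε' : 0 < ε := hε
    rw [sub_eq_add_neg, Real.rpow_add hε', Real.rpow_one, ← mul_assoc]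
    exact mul_le_mul_of_nonneg_right h (Real.rpow_pos_of_pos hε' _).le

theorem integral_rpow_mul_div_eq (k : ℝ → ℝ) {T : ℝ} (hT : 1 ≤ T) :
    ∫ ε in (1 / T)..1, ε ^ (-α) * k ε / ε = ∫ t in (0 : ℝ)..Real.log T, logRescale α k t := by
  have hT0 : 0 < T := zero_lt_one.trans_le hT
  have himg : (fun t : ℝ => Real.exp (-t)) '' Ico 0 (Real.log T) = Ioc (1 / T) 1 := by
    ext x
    constructor
    · rintro ⟨t, ⟨h0, h1⟩, rfl⟩
      refine ⟨?_, by simpa using h0⟩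
      rw [one_div, ← Real.exp_log hT0, ← Real.exp_neg]
      exact Real.exp_lt_exp.2 (neg_lt_neg h1)
    · rintro ⟨h0, h1⟩
      have hx : 0 < x := (by positivity : 0 < 1 / T).trans h0
      refine ⟨-Real.log x, ⟨by simpa using Real.log_nonpos hx.le h1, ?_⟩,
        by simp [Real.exp_log hx]⟩
      have := Real.log_lt_log (by positivity) h0
      rw [one_div, Real.log_inv] at this
      linarith
  rw [intervalIntegral.integral_of_le ((div_le_one hT0).2 hT),
    intervalIntegral.integral_of_le (Real.log_nonneg hT), ← himg,
    integral_image_eq_integral_abs_deriv_smul measurableSet_Ico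
      (f' := fun t => -Real.exp (-t)) (fun x _ => by
        have := ((hasDerivAt_id x).neg.exp).hasDerivWithinAt (s := Ico 0 (Real.log T))
        simpa using this)
      (fun x _ y _ hxy => by simpa using hxy), integral_Ico_eq_integral_Ioc]
  refine setIntegral_congr_fun measurableSet_Ioc fun t _ => ?_
  simp only [abs_neg, abs_of_pos (Real.exp_pos _), smul_eq_mul, logRescale]
  rw [← Real.exp_mul, show -t * -α = α * t by ring]
  field_simp

/-- The rescaled difference is at most K e^((α-1)t), integrable on the half-line, so its mean over
[0, T] is O(1/T). -/
theorem tendsto_average_of_le {K : ℝ} (hk : Monotone k) (hf : Monotone f) (hα : α < 1)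
    (hlow : ∀ ε, f ε ≤ k ε) (hup : ∀ ε, 0 ≤ ε → ε ≤ 1 → k ε ≤ f ε + K * ε) {L : ℝ}
    (h : Tendsto (fun T : ℝ => (∫ t in (0 : ℝ)..T, logRescale α f t) / T) atTop (𝓝 L)) :
    Tendsto (fun T : ℝ => (∫ t in (0 : ℝ)..T, logRescale α k t) / T) atTop (𝓝 L) := by
  have hint : IntegrableOn (fun t : ℝ => K * Real.exp ((α - 1) * t)) (Ioi 0) :=
    (integrableOn_exp_mul_Ioi (by linarith) 0).const_mul K
  set E := ∫ t in Ioi (0 : ℝ), K * Real.exp ((α - 1) * t) with hE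
  have hK : 0 ≤ K := by
    have := hup 1 zero_le_one le_rfl
    linarith [hlow 1]
  have hdiff : Tendsto (fun T : ℝ => (∫ t in (0 : ℝ)..T, logRescale α k t) / T -
      (∫ t in (0 : ℝ)..T, logRescale α f t) / T) atTop (𝓝 0) := by
    refine squeeze_zero' ?_ ?_ (tendsto_const_nhds.div_atTop tendsto_id : Tendsto
      (fun T : ℝ => E / T) atTop (𝓝 0))
    · filter_upwards [eventually_gt_atTop 0] with T hT
      rw [← sub_div, ← intervalIntegral.integral_sub (intervalIntegrable_logRescale hk _ _)
        (intervalIntegrable_logRescale hf _ _)]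
      refine div_nonneg (intervalIntegral.integral_nonneg hT.le fun t _ => ?_) hT.le
      exact sub_nonneg.2 (mul_le_mul_of_nonneg_left (hlow _) (Real.exp_pos _).le)
    · filter_upwards [eventually_gt_atTop 0] with T hT
      rw [← sub_div, ← intervalIntegral.integral_sub (intervalIntegrable_logRescale hk _ _)
        (intervalIntegrable_logRescale hf _ _)]
      refine div_le_div_of_nonneg_right ?_ hT.le
      calc ∫ t in (0 : ℝ)..T, (logRescale α k t - logRescale α f t)
          ≤ ∫ t in (0 : ℝ)..T, K * Real.exp ((α - 1) * t) := by
            refine intervalIntegral.integral_mono_on hT.le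
              ((intervalIntegrable_logRescale hk _ _).sub (intervalIntegrable_logRescale hf _ _))
              (Continuous.intervalIntegrable (by fun_prop) _ _) fun t ht => ?_
            have h1 := hup (Real.exp (-t)) (Real.exp_pos _).le (by simpa using ht.1)
            have h2 : Real.exp ((α - 1) * t) = Real.exp (α * t) * Real.exp (-t) := by
              rw [← Real.exp_add]; ring_nf
            rw [logRescale, logRescale, h2]
            nlinarith [mul_le_mul_of_nonneg_left h1 (Real.exp_pos (α * t)).le]
        _ ≤ E := by
            rw [intervalIntegral.integral_of_le hT.le]
            exact setIntegral_mono_set hint (Eventually.of_forall fun t => by positivity)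
              Ioc_subset_Ioi_self.eventuallyLE
  simpa using hdiff.add h

end LogRescale

/-! ### Steiner-like functions -/

section Steiner

variable {d : ℕ} {D g v : ℝ} {k : ℝ → ℝ} {κ : ℕ → ℝ}

theorem logRescale_eq_sum (hg : 0 < g)
    (hk : ∀ ε, 0 < ε → ε < g → k ε = ∑ m ∈ Finset.range d, κ m * ε ^ (d - m)) {t : ℝ}
    (ht : -Real.log g < t) :
    logRescale (d - D) k t = ∑ m ∈ Finset.range d, κ m * Real.exp ((m - D) * t) := by
  rw [logRescale, hk _ (Real.exp_pos _) ((Real.lt_log_iff_exp_lt hg).1 (by linarith)),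
    Finset.mul_sum]
  refine Finset.sum_congr rfl fun m hm => ?_
  rw [mul_left_comm, ← Real.exp_nat_mul, ← Real.exp_add, Nat.cast_sub (Finset.mem_range.1 hm).le]
  ring_nf

theorem logRescale_eq_const_mul (hg : 0 < g) (hk : ∀ ε, g ≤ ε → k ε = v) {t : ℝ}
    (ht : t ≤ -Real.log g) : logRescale (d - D) k t = v * Real.exp ((d - D) * t) := by
  rw [logRescale, hk _ ((Real.log_le_iff_le_exp hg).1 (by linarith)), mul_comm]

/-- Split at c = -log g. To the right the exponents m - D with m < d are negative; to the left the
function is -κ_d e^((d-D)t) with d - D > 0. The sign convention for κ_d makes the left piece the m =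
d term of the sum. -/
theorem integrable_logRescale_and_integral_eq (hD1 : (d : ℝ) - 1 < D) (hDd : D < d) (hg : 0 < g)
    (hk : ∀ ε, 0 < ε → ε < g → k ε = ∑ m ∈ Finset.range d, κ m * ε ^ (d - m))
    (hk' : ∀ ε, g ≤ ε → k ε = -κ d) :
    Integrable (logRescale (d - D) k) ∧
      ∫ t, logRescale (d - D) k t = ∑ m ∈ Finset.range (d + 1), g ^ (D - m) / (D - m) * κ m := by
  have hneg : ∀ m ∈ Finset.range d, (m : ℝ) - D < 0 := fun m hm => by
    have : (m : ℝ) + 1 ≤ d := by exact_mod_cast Finset.mem_range.1 hm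
    linarith
  have hpos : 0 < (d : ℝ) - D := by linarith
  set c := -Real.log g with hc
  have e1 : EqOn (fun t => ∑ m ∈ Finset.range d, κ m * Real.exp ((m - D) * t))
      (logRescale (d - D) k) (Ioi c) := fun t ht => (logRescale_eq_sum hg hk ht).symm
  have e2 : EqOn (fun t => -κ d * Real.exp ((d - D) * t))
      (logRescale (d - D) k) (Iic c) := fun t ht => (logRescale_eq_const_mul hg hk' ht).symm
  have i1' : ∀ m ∈ Finset.range d, IntegrableOn (fun t => κ m * Real.exp ((m - D) * t)) (Ioi c) :=
    fun m hm => (integrableOn_exp_mul_Ioi (hneg m hm) c).const_mul _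
  have i1 : IntegrableOn (logRescale (d - D) k) (Ioi c) :=
    IntegrableOn.congr_fun (integrable_finsetSum _ i1') e1 measurableSet_Ioi
  have i2 : IntegrableOn (logRescale (d - D) k) (Iic c) :=
    IntegrableOn.congr_fun ((integrableOn_exp_mul_Iic hpos c).const_mul _) e2 measurableSet_Iic
  have hi : Integrable (logRescale (d - D) k) := by
    rw [← integrableOn_univ, ← Iic_union_Ioi (a := c)]
    exact i2.union i1
  refine ⟨hi, ?_⟩
  have hgpow : ∀ x : ℝ, Real.exp (-x * c) = g ^ x := fun x => by
    rw [Real.rpow_def_of_pos hg, hc]; ring_nf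
  rw [← intervalIntegral.integral_Iic_add_Ioi i2 i1, ← setIntegral_congr_fun measurableSet_Ioi e1,
    ← setIntegral_congr_fun measurableSet_Iic e2, integral_finsetSum _ i1', Finset.sum_range_succ,
    integral_const_mul, integral_exp_mul_Iic hpos, add_comm]
  congr 1
  · refine Finset.sum_congr rfl fun m hm => ?_
    rw [integral_const_mul, integral_exp_mul_Ioi (hneg m hm), ← hgpow, neg_sub,
      neg_div, ← div_neg, neg_sub, mul_comm]
  · rw [← hgpow, neg_sub, ← neg_sub (d : ℝ) D, div_neg]
    ring

theorem exists_le_mul_of_steiner (hg : 0 < g) {V : ℝ} (hV : ∀ ε, k ε ≤ V) (hV0 : 0 ≤ V)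
    (hk : ∀ ε, 0 < ε → ε < g → k ε = ∑ m ∈ Finset.range d, κ m * ε ^ (d - m)) :
    ∃ A : ℝ, 0 ≤ A ∧ ∀ ε, 0 < ε → k ε ≤ A * ε := by
  refine ⟨∑ m ∈ Finset.range d, |κ m| + V / min g 1, by positivity, fun ε hε => ?_⟩
  have hm : 0 < min g 1 := lt_min hg one_pos
  rw [add_mul]
  rcases lt_or_ge ε (min g 1) with h | h
  · have h1 : 0 ≤ V / min g 1 * ε := by positivity
    refine le_trans ?_ (le_add_of_nonneg_right h1)
    rw [hk ε hε (h.trans_le (min_le_left _ _)), Finset.sum_mul]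
    refine Finset.sum_le_sum fun m hm => ?_
    have h2 : ε ^ (d - m) ≤ ε := by
      have := Finset.mem_range.1 hm
      simpa using pow_le_pow_of_le_one hε.le (h.le.trans (min_le_right _ _))
        (show 1 ≤ d - m by omega)
    calc κ m * ε ^ (d - m) ≤ |κ m| * ε ^ (d - m) :=
          mul_le_mul_of_nonneg_right (le_abs_self _) (by positivity)
      _ ≤ |κ m| * ε := mul_le_mul_of_nonneg_left h2 (abs_nonneg _)
  · have h1 : V ≤ V / min g 1 * ε := by
      rw [div_mul_eq_mul_div, le_div_iff₀ hm]
      exact mul_le_mul_of_nonneg_left h hV0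
    have h2 : 0 ≤ (∑ m ∈ Finset.range d, |κ m|) * ε := by positivity
    linarith [hV ε]

end Steiner

/-! ### The lattice case -/

section Lattice

/-- The first lattice point beyond c is (⌊c/η⌋ + 1)η, so a gap follows c even when c is itself in
the lattice. -/
theorem eventually_add_le_of_mem_zmultiples {η : ℝ} (hη : 0 < η) (c : ℝ) :
    ∀ᶠ τ : ℝ in 𝓝[>] 0, ∀ t ∈ AddSubgroup.zmultiples η, c < t → c + τ ≤ t := by
  have hpos : 0 < (⌊c / η⌋ + 1) * η - c := by
    have := (div_lt_iff₀ hη).1 (Int.lt_floor_add_one (c / η))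
    linarith
  filter_upwards [nhdsWithin_le_nhds (eventually_lt_nhds hpos)] with τ hτ t ht hct
  obtain ⟨n, rfl⟩ := AddSubgroup.mem_zmultiples_iff.1 ht
  rw [zsmul_eq_mul] at hct ⊢
  have h1 : ⌊c / η⌋ + 1 ≤ n := by
    have : c / η < n := (div_lt_iff₀ hη).2 hct
    exact Int.add_one_le_iff.2 (Int.floor_lt.2 this)
  have h2 : ((⌊c / η⌋ : ℝ) + 1) * η ≤ n * η :=
    mul_le_mul_of_nonneg_right (by exact_mod_cast h1) hη.le
  linarith

variable {d J Q : ℕ} {D : ℝ} {p a : Fin J → ℝ} {Z z : ℝ → ℝ} {c : Fin Q → ℝ}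
  {κ : Fin Q → ℕ → ℝ} {v : Fin Q → ℝ} {zq : Fin Q → ℝ → ℝ}

/-- A polynomial P in a small translation kills all exponentials e^((m-D)t), 0 ≤ m ≤ d. Applied to Z
it gives U, which solves the homogeneous equation on the lattice and so vanishes there. Along the
lattice U also tends to P(1) L, and P(1) ≠ 0. -/
theorem eq_zero_of_tendsto_of_lattice (hp : ∀ j, 0 < p j) (hp1 : ∑ j, p j = 1)
    (ha : ∀ j, 0 < a j) (hrec : ∀ t, Z t = z t + ∑ j, p j * Z (t - a j))
    (hbot : Tendsto Z atBot (𝓝 0)) {η : ℝ} (hη : 0 < η)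
    (haη : ∀ j, a j ∈ AddSubgroup.zmultiples η) (hD : ∀ m ∈ Finset.range (d + 1), (m : ℝ) ≠ D)
    (hz : ∀ t, z t = ∑ q, zq q t)
    (hzq : ∀ q t, c q < t → zq q t = ∑ m ∈ Finset.range d, κ q m * Real.exp ((m - D) * t))
    (hzq' : ∀ q t, t ≤ c q → zq q t = v q * Real.exp ((d - D) * t))
    {L : ℝ} (hL : Tendsto Z atTop (𝓝 L)) : L = 0 := by
  obtain ⟨τ, hτ, hτ0⟩ := ((eventually_all.2 fun q =>
    eventually_add_le_of_mem_zmultiples hη (c q)).and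
      (self_mem_nhdsWithin (a := (0 : ℝ)) (s := Ioi 0))).exists
  replace hτ0 : 0 < τ := hτ0
  -- The translations (i + 1)δ, i ≤ d + 1, are at most (d + 2)δ < τ.
  set δ := τ / (d + 3) with hδ
  have hδ0 : 0 < δ := by positivity
  set P : Polynomial ℝ := ∏ m ∈ Finset.range (d + 1),
    (Polynomial.X - Polynomial.C (Real.exp ((m - D) * -δ))) with hP
  have hdeg : P.natDegree = d + 1 := by
    rw [hP, Polynomial.natDegree_prod_of_monic _ _ fun m _ => Polynomial.monic_X_sub_C _]
    simp
  have hroot : ∀ m ∈ Finset.range (d + 1), P.eval (Real.exp ((m - D) * -δ)) = 0 := fun m hm => by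
    rw [hP, Polynomial.eval_prod]
    exact Finset.prod_eq_zero hm (by simp)
  have hone : P.eval 1 ≠ 0 := by
    rw [hP, Polynomial.eval_prod]
    refine Finset.prod_ne_zero_iff.2 fun m hm => ?_
    rw [Polynomial.eval_sub, Polynomial.eval_X, Polynomial.eval_C, sub_ne_zero, ne_comm,
      Ne, Real.exp_eq_one_iff]
    exact mul_ne_zero (sub_ne_zero.2 (hD m hm)) (neg_ne_zero.2 hδ0.ne')
  -- the combination of translates with the coefficients of `P` annihilates the exponentials
  have hexp : ∀ m ∈ Finset.range (d + 1), ∀ t : ℝ, ∑ i ∈ Finset.range (d + 2),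
      P.coeff i * Real.exp ((m - D) * (t - (i + 1) * δ)) = 0 := by
    intro m hm t
    have h1 := hroot m hm
    rw [Polynomial.eval_eq_sum_range, hdeg] at h1
    calc _ = Real.exp ((m - D) * (t - δ)) * ∑ i ∈ Finset.range (d + 1 + 1),
          P.coeff i * Real.exp ((m - D) * -δ) ^ i := by
          rw [Finset.mul_sum]
          refine Finset.sum_congr rfl fun i _ => ?_
          rw [mul_left_comm, ← Real.exp_nat_mul, ← Real.exp_add]
          ring_nf
      _ = 0 := by rw [h1, mul_zero]
  have hoff : ∀ i ∈ Finset.range (d + 2), ((i : ℝ) + 1) * δ < τ := fun i hi => by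
    have : (i : ℝ) + 1 ≤ d + 2 := by exact_mod_cast Finset.mem_range.1 hi
    rw [hδ, ← mul_div_assoc, div_lt_iff₀ (by positivity)]
    nlinarith
  have hzero : ∀ t ∈ AddSubgroup.zmultiples η,
      ∑ i ∈ Finset.range (d + 2), P.coeff i * z (t - (i + 1) * δ) = 0 := by
    intro t ht
    simp only [hz, Finset.mul_sum]
    rw [Finset.sum_comm]
    refine Finset.sum_eq_zero fun q _ => ?_
    -- By the choice of τ, all translates of a lattice point t lie on the same side of the
    -- breakpoint c_q as t, so a single exponential formula applies to all of them.
    rcases lt_or_ge (c q) t with h | h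
    · have h1 := hτ q t ht h
      have h2 : ∀ i ∈ Finset.range (d + 2), P.coeff i * zq q (t - (i + 1) * δ)
          = ∑ m ∈ Finset.range d,
            κ q m * (P.coeff i * Real.exp ((m - D) * (t - (i + 1) * δ))) := fun i hi => by
        rw [hzq q _ (by linarith [hoff i hi]), Finset.mul_sum]
        exact Finset.sum_congr rfl fun m _ => by ring
      rw [Finset.sum_congr rfl h2, Finset.sum_comm]
      refine Finset.sum_eq_zero fun m hm => ?_
      rw [← Finset.mul_sum, hexp m (Finset.mem_range.2
        ((Finset.mem_range.1 hm).trans (Nat.lt_succ_self d))), mul_zero]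
    · have h2 : ∀ i ∈ Finset.range (d + 2), P.coeff i * zq q (t - (i + 1) * δ)
          = v q * (P.coeff i * Real.exp ((d - D) * (t - (i + 1) * δ))) := fun i hi => by
        rw [hzq' q _ (by have : 0 ≤ ((i : ℝ) + 1) * δ := by positivity
                         linarith)]
        ring
      rw [Finset.sum_congr rfl h2, ← Finset.mul_sum, hexp d (Finset.self_mem_range_succ d),
        mul_zero]
  set U : ℝ → ℝ := fun t => ∑ i ∈ Finset.range (d + 2), P.coeff i * Z (t - (i + 1) * δ) with hU
  have hUrec : ∀ t ∈ AddSubgroup.zmultiples η, U t = ∑ j, p j * U (t - a j) := by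
    intro t ht
    simp only [hU, Finset.mul_sum]
    rw [Finset.sum_comm]
    have h1 : ∀ i ∈ Finset.range (d + 2), P.coeff i * Z (t - (i + 1) * δ)
        = P.coeff i * z (t - (i + 1) * δ)
          + ∑ j, p j * (P.coeff i * Z (t - a j - (i + 1) * δ)) := fun i _ => by
      rw [hrec, mul_add, Finset.mul_sum]
      congr 1
      refine Finset.sum_congr rfl fun j _ => ?_
      rw [sub_right_comm]
      ring
    rw [Finset.sum_congr rfl h1, Finset.sum_add_distrib, hzero t ht, zero_add]
  have hUbot : Tendsto U atBot (𝓝 0) := by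
    rw [show (0 : ℝ) = ∑ i ∈ Finset.range (d + 2), P.coeff i * 0 by simp]
    exact tendsto_finsetSum _ fun i _ => (hbot.comp
      (tendsto_atBot_add_const_right atBot (-((i + 1) * δ)) tendsto_id)).const_mul _
  have hUtop : Tendsto U atTop (𝓝 (P.eval 1 * L)) := by
    rw [Polynomial.eval_eq_sum_range, hdeg, Finset.sum_mul]
    simp only [one_pow, mul_one]
    exact tendsto_finsetSum _ fun i _ => (hL.comp
      (tendsto_atTop_add_const_right atTop (-((i + 1) * δ)) tendsto_id)).const_mul _
  have hU0 := eq_zero_of_homogeneous_renewal hp hp1 ha haη hUrec hUbot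
  have hseq : Tendsto (fun n : ℕ => (n : ℝ) * η) atTop atTop :=
    tendsto_natCast_atTop_atTop.atTop_mul_const hη
  have h0 : P.eval 1 * L = 0 := by
    refine tendsto_nhds_unique (hUtop.comp hseq) (tendsto_const_nhds.congr fun n => ?_)
    refine (hU0 _ ?_).symm
    exact AddSubgroup.mem_zmultiples_iff.2 ⟨n, by simp⟩
  exact (mul_eq_zero.1 h0).resolve_left hone

end Lattice

/-! ### Residues -/

section Residue

theorem hasResidueAt_of_eventuallyEq {f g : ℂ → ℂ} {a : ℂ} (hg : AnalyticAt ℂ g a)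
    (hf : f =ᶠ[𝓝[≠] a] fun s => (s - a)⁻¹ * g s) : HasResidueAt f a (g a) := by
  refine ⟨MeromorphicAt.congr (f := fun s => (s - a)⁻¹ * g s) ?_ hf.symm, ?_⟩
  · exact (((MeromorphicAt.id a).sub (MeromorphicAt.const a a)).inv).mul hg.meromorphicAt
  · obtain ⟨R, hR, hRf⟩ := Metric.eventually_nhds_iff_ball.1
      ((eventually_nhdsWithin_iff.1 hf).and hg.eventually_analyticAt)
    filter_upwards [Ioo_mem_nhdsGT hR] with ρ hρ
    have hsub : Metric.closedBall a ρ ⊆ Metric.ball a R := Metric.closedBall_subset_ball hρ.2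
    have hcongr : (∮ z in C(a, ρ), f z) = ∮ z in C(a, ρ), (z - a)⁻¹ • g z := by
      refine circleIntegral.integral_congr hρ.1.le fun z hz => ?_
      refine (hRf z (hsub (Metric.sphere_subset_closedBall hz))).1 ?_
      exact ne_of_mem_of_not_mem hz (by simpa using hρ.1.ne)
    have hd : DifferentiableOn ℂ g (Metric.ball a R) := fun z hz =>
      (hRf z hz).2.differentiableAt.differentiableWithinAt
    rw [hcongr, (hd.diffContOnCl_ball hsub).circleIntegral_sub_inv_smul
      (Metric.mem_ball_self hρ.1), smul_eq_mul, inv_mul_cancel_left₀ Complex.two_pi_I_ne_zero]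

/-- Near a, N(s) = (s - a) n(s) with n = `dslope N a` analytic and n(a) = μ ≠ 0; Cauchy's formula
then applies to K/n. -/
theorem hasResidueAt_div_of_simple_zero {K N : ℂ → ℂ} {a μ : ℂ} (hK : AnalyticAt ℂ K a)
    (hN : AnalyticAt ℂ N a) (hN0 : N a = 0) (hμ : HasDerivAt N μ a) (hμ0 : μ ≠ 0) {f : ℂ → ℂ}
    (hf : f =ᶠ[𝓝[≠] a] fun s => K s / N s) : HasResidueAt f a (K a / μ) := by
  obtain ⟨q, hq⟩ := hN
  have hn : AnalyticAt ℂ (dslope N a) a := ⟨_, hq.has_fpower_series_dslope_fslope⟩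
  have hna : dslope N a a = μ := by rw [dslope_same, hμ.deriv]
  have := hasResidueAt_of_eventuallyEq (f := f) (hK.div hn (by rwa [hna])) ?_
  · simpa [hna, hμ.deriv] using this
  · filter_upwards [hf, self_mem_nhdsWithin] with s hs hsa
    have hsa' : s - a ≠ 0 := sub_ne_zero.2 hsa
    rw [hs, Pi.div_apply, dslope_of_ne _ hsa, slope_def_field, hN0, sub_zero]
    rw [div_div_eq_mul_div, ← mul_div_assoc, inv_mul_eq_div, mul_div_cancel_right₀ _ hsa']

end Residue

/-! ### Residues of the zeta functions -/

section ZetaResidue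

variable {d J Q : ℕ} {r : Fin J → ℝ} {D μ g : ℝ} {κ : ℕ → ℝ}

theorem hasDerivAt_one_sub_sum_cpow (hr : ∀ j, 0 < r j) (D : ℝ) :
    HasDerivAt (fun s : ℂ => 1 - ∑ j, (r j : ℂ) ^ s)
      ((∑ j, r j ^ D * Real.log (r j)⁻¹ : ℝ) : ℂ) D := by
  have h1 : ∀ j ∈ Finset.univ, HasDerivAt (fun s : ℂ => (r j : ℂ) ^ s)
      ((r j : ℂ) ^ (D : ℂ) * Complex.log (r j) * 1) D := fun j _ =>
    (hasDerivAt_id (D : ℂ)).const_cpow (Or.inl (by exact_mod_cast (hr j).ne'))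
  refine ((HasDerivAt.fun_sum h1).const_sub 1).congr_deriv ?_
  push_cast
  rw [← Finset.sum_neg_distrib]
  refine Finset.sum_congr rfl fun j _ => ?_
  rw [Real.log_inv, ← Complex.ofReal_log (hr j).le, ← Complex.ofReal_cpow (hr j).le]
  push_cast
  ring

theorem analyticAt_one_sub_sum_cpow (hr : ∀ j, 0 < r j) (s : ℂ) :
    AnalyticAt ℂ (fun s : ℂ => 1 - ∑ j, (r j : ℂ) ^ s) s := by
  have h : Differentiable ℂ fun z : ℂ => 1 - ∑ j, (r j : ℂ) ^ z :=
    (differentiable_const _).sub (Differentiable.fun_sum fun j _ =>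
      differentiable_id.const_cpow (Or.inl (by exact_mod_cast (hr j).ne')))
  exact h.analyticAt s

theorem analyticAt_sum_cpow_div (hg : 0 < g) (hD : ∀ m ∈ Finset.range (d + 1), (m : ℝ) ≠ D) :
    AnalyticAt ℂ (fun s : ℂ => ∑ m ∈ Finset.range (d + 1),
      (g : ℂ) ^ (s - m) / (s - m) * (κ m : ℂ)) D := by
  refine Finset.analyticAt_fun_sum _ fun m hm => ?_
  have h1 : AnalyticAt ℂ (fun s : ℂ => s - m) D := analyticAt_id.sub analyticAt_const
  have h2 : AnalyticAt ℂ (fun s : ℂ => (g : ℂ) ^ (s - m)) D := by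
    have : Differentiable ℂ fun s : ℂ => (g : ℂ) ^ (s - m) :=
      (differentiable_id.sub_const _).const_cpow (Or.inl (by exact_mod_cast hg.ne'))
    exact this.analyticAt _
  refine (h2.div h1 ?_).mul analyticAt_const
  rw [sub_ne_zero]
  exact_mod_cast (hD m hm).symm

/-- Serves three choices of K: the sum over all generators, the term of one generator, and the
constant 1. -/
theorem hasResidueAt_scalingZeta_mul (hr : ∀ j, 0 < r j) (hmoran : ∑ j, r j ^ D = 1)
    (hμ0 : ∑ j, r j ^ D * Real.log (r j)⁻¹ ≠ 0) {K f : ℂ → ℂ} {x : ℝ}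
    (hK : AnalyticAt ℂ K D) (hKx : K D = x) (hf : ∀ s, f s = scalingZeta r s * K s) :
    HasResidueAt f D ((x / ∑ j, r j ^ D * Real.log (r j)⁻¹ : ℝ) : ℂ) := by
  have h0 : (fun s : ℂ => 1 - ∑ j, (r j : ℂ) ^ s) (D : ℂ) = 0 := by
    have : ∑ j, (r j : ℂ) ^ (D : ℂ) = ((∑ j, r j ^ D : ℝ) : ℂ) := by
      push_cast
      exact Finset.sum_congr rfl fun j _ => (Complex.ofReal_cpow (hr j).le D).symm
    simp only [this, hmoran, Complex.ofReal_one, sub_self]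
  have := hasResidueAt_div_of_simple_zero (f := f) hK (analyticAt_one_sub_sum_cpow hr D) h0
    (hasDerivAt_one_sub_sum_cpow hr D) (by exact_mod_cast hμ0)
    (Eventually.of_forall fun s => by rw [hf, scalingZeta]; ring)
  rwa [hKx, ← Complex.ofReal_div] at this

theorem geometricZeta_mul_cpow (G : Set (Euc d)) {ε : ℝ} (hε : 0 < ε) (s : ℂ) :
    geometricZeta r G κ s ε * (ε : ℂ) ^ (s - (d : ℂ)) = scalingZeta r s *
      ∑ m ∈ Finset.range (d + 1), (inradius G : ℂ) ^ (s - m) / (s - m) * (κ m : ℂ) := by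
  have h1 : (ε : ℂ) ^ ((d : ℂ) - s) * (ε : ℂ) ^ (s - (d : ℂ)) = 1 := by
    rw [← Complex.cpow_add _ _ (by exact_mod_cast hε.ne')]
    simp
  rw [geometricZeta, mul_right_comm _ _ ((ε : ℂ) ^ (s - (d : ℂ))), mul_assoc (scalingZeta r s), h1,
    mul_one]

theorem sum_cpow_div_ofReal (hg : 0 < g) (D : ℝ) :
    ∑ m ∈ Finset.range (d + 1), (g : ℂ) ^ ((D : ℂ) - m) / ((D : ℂ) - m) * (κ m : ℂ)
      = ((∑ m ∈ Finset.range (d + 1), g ^ (D - m) / (D - m) * κ m : ℝ) : ℂ) := by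
  push_cast
  refine Finset.sum_congr rfl fun m _ => ?_
  rw [Complex.ofReal_cpow hg.le]
  push_cast
  rfl

end ZetaResidue

theorem closure_range_log_inv {J : ℕ} (r : Fin J → ℝ) :
    AddSubgroup.closure (Set.range fun j => Real.log (r j)⁻¹)
      = AddSubgroup.closure (Set.range fun j => Real.log (r j)) := by
  refine le_antisymm ((AddSubgroup.closure_le _).2 ?_) ((AddSubgroup.closure_le _).2 ?_)
  · rintro _ ⟨j, rfl⟩
    simp only [Real.log_inv]
    exact neg_mem (AddSubgroup.subset_closure ⟨j, rfl⟩)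
  · rintro _ ⟨j, rfl⟩
    simp only []
    rw [← neg_neg (Real.log (r j)), ← Real.log_inv]
    exact neg_mem (AddSubgroup.subset_closure ⟨j, rfl⟩)

end Fractal

/-! ### Assembly of the main theorem. -/

open Fractal in
theorem theorem2 {d J Q : ℕ} (hJ : 2 ≤ J)
    (φ : Fin J → Fractal.Euc d → Fractal.Euc d) (r : Fin J → ℝ)
    (hφ : ∀ j, Fractal.IsSimilitude (φ j) (r j))
    (F : Set (Fractal.Euc d)) (hF : Fractal.IsAttractor φ F)
    (hdim : Module.finrank ℝ (vectorSpan ℝ (convexHull ℝ F)) = d)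
    (hTSC : Fractal.TilesetCondition φ F)
    (hNTC : Fractal.NontrivialityCondition φ F)
    (hPWC : Fractal.PearseWinterCondition F)
    (G : Fin Q → Set (Fractal.Euc d)) (hG : Fractal.AreGenerators φ F G)
    (κ : Fin Q → ℕ → ℝ) (hκ : ∀ q, Fractal.IsSteinerLike (G q) (κ q))
    (D : ℝ) (hD : D = Fractal.minkowskiDim F) (hDd : (d : ℝ) - 1 < D) :
    -- `D` solves the Moran equation, and it is the Minkowski dimension also as a limit
    ∑ j, r j ^ D = 1 ∧
    Tendsto (fun ε : ℝ => (d : ℝ) - Real.log (Fractal.tubeVolume F ε) / Real.log ε)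
      (𝓝[>] 0) (𝓝 D) ∧
    -- `M` is the residue at `D` of `ζ_T(s, ε) ε ^ (s - d)`, and `μ q` is the contribution
    -- of the generator `G q` to it
    ∃ (M : ℝ) (μ : Fin Q → ℝ),
      (∀ ε : ℝ, 0 < ε → Fractal.HasResidueAt
        (fun s => Fractal.totalGeometricZeta r G κ s ε * (ε : ℂ) ^ (s - (d : ℂ))) D M) ∧
      (∀ q, ∀ ε : ℝ, 0 < ε → Fractal.HasResidueAt
        (fun s => Fractal.geometricZeta r (G q) (κ q) s ε * (ε : ℂ) ^ (s - (d : ℂ)))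
        D (μ q)) ∧
      M = ∑ q, μ q ∧
      (∃ ρ : ℝ, Fractal.HasResidueAt (Fractal.scalingZeta r) D ρ ∧
        M = ρ * ∑ q, ∑ m ∈ Finset.range (d + 1),
          Fractal.inradius (G q) ^ (D - m) / (D - m) * κ q m) ∧
      M = (∑ q, ∑ m ∈ Finset.range (d + 1),
          Fractal.inradius (G q) ^ (D - m) / (D - m) * κ q m) /
        ∑ j, r j ^ D * Real.log (r j)⁻¹ ∧
      -- part I
      (¬ Fractal.IsLatticeType r → Fractal.HasMinkowskiContent F M) ∧
      -- part II
      (Fractal.IsLatticeType r →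
        ¬ Fractal.IsMinkowskiMeasurable F ∧ Fractal.HasAverageMinkowskiContent F M) := by
  have hr : ∀ j, 0 < r j := fun j => (hφ j).1
  have hr1 : ∀ j, r j < 1 := fun j => (hφ j).2.1
  have hd : 0 < d := hTSC.pos_dim hJ
  have hVfin : 0 ≤ volume.real (convexHull ℝ F) := measureReal_nonneg
  -- the generators
  have hbdd : ∀ q, Bornology.IsBounded (G q) := fun q => (hκ q).1
  have hg : ∀ q, 0 < inradius (G q) := fun q =>
    inradius_pos hd (hbdd q) (hG.1 q) (hG.2.1 q).nonempty
  have hk : ∀ q ε, 0 < ε → ε < inradius (G q) →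
      innerTubeVolume (G q) ε = ∑ m ∈ Finset.range d, κ q m * ε ^ (d - m) :=
    fun q => (hκ q).2.2.1
  have hk' : ∀ q ε, inradius (G q) ≤ ε → innerTubeVolume (G q) ε = -κ q d := fun q ε hε => by
    rw [(hκ q).2.2.2, neg_neg, ← hG.volumeReal_inter_cthickening_compl hφ hF hPWC,
      inter_cthickening_compl_eq hd (hbdd q) hε]
  have hkV : ∀ q ε, innerTubeVolume (G q) ε ≤ volume.real (convexHull ℝ F) := fun q ε => by
    rw [← hG.volumeReal_inter_cthickening hφ hF hPWC]
    exact measureReal_mono (inter_subset_left.trans (hG.subset_convexHull q))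
      (hF.isCompact_convexHull hPWC).measure_lt_top.ne
  choose A hA0 hA using fun q => exists_le_mul_of_steiner (hg q) (hkV q) hVfin (hk q)
  set f := hullTube F with hf
  set h : ℝ → ℝ := fun ε => ∑ q, innerTubeVolume (G q) ε with hh
  have hh0 : ∀ ε, 0 ≤ h ε := fun ε => Finset.sum_nonneg fun q _ => measureReal_nonneg
  have hhA : ∀ ε, 0 < ε → h ε ≤ (∑ q, A q) * ε := fun ε hε => by
    rw [Finset.sum_mul]
    exact Finset.sum_le_sum fun q _ => hA q ε hε
  have hA0' : 0 ≤ ∑ q, A q := Finset.sum_nonneg fun q _ => hA0 q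
  have hrec : ∀ ε, f ε = h ε + ∑ j, r j ^ d * f (ε / r j) := hullTube_eq hφ hF hTSC hPWC hG
  have hfmono : Monotone f := hF.hullTube_mono hPWC
  have hfpos : ∀ ε, 0 < ε → 0 < f ε := fun ε => hF.hullTube_pos hTSC hPWC
  have hf0 : ∀ ε, 0 ≤ f ε := fun ε => measureReal_nonneg
  have hfV : ∀ ε, f ε ≤ volume.real (convexHull ℝ F) := hF.hullTube_le hPWC
  have hlow : ∀ ε, f ε ≤ tubeVolume F ε := hF.hullTube_le_tubeVolume
  obtain ⟨K, hK0, hup⟩ := hF.exists_tubeVolume_le hTSC hPWC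
  have hVmono : Monotone (tubeVolume F) := fun _ _ hab =>
    measureReal_mono (Metric.cthickening_mono hab F) hF.2.1.cthickening.measure_lt_top.ne
  -- the Moran equation
  obtain ⟨D₀, hD₀, hD₀d, hmoran⟩ := exists_moran_exponent hJ hr
    (sum_pow_dim_lt_one hφ hF hTSC hNTC hPWC hG)
  obtain rfl : D = D₀ := hD.trans (minkowskiDim_eq_of_moran hJ hr hr1 hrec hfmono hfpos hfV
    (fun ε _ => hh0 ε) hA0' hhA hlow hK0 hup hD₀ hD₀d hmoran (hD ▸ hDd))
  set α := (d : ℝ) - D with hα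
  have hα0 : 0 < α := by linarith
  have hα1 : α < 1 := by linarith
  have hDα : (d : ℝ) - α = D := by rw [hα]; ring
  have hmoran' : ∑ j, r j ^ ((d : ℝ) - α) = 1 := by rwa [hDα]
  obtain ⟨B, hB0, hB⟩ := exists_le_rpow_of_sum_eq_one (α := α) hr hr1 hrec hVfin hfV hα0.le hα1.le
    hA0' hhA hmoran' (by have := sum_rpow_lt hJ hr hr1 hDd; rwa [hmoran] at this)
  obtain ⟨c, hc, hcf⟩ := exists_rpow_le_of_sum_eq_one hr hr1 hrec hfmono hfpos hα0.le
    (fun ε _ => hh0 ε) hmoran'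
  have hev : ∀ᶠ ε : ℝ in 𝓝[>] 0, 0 < ε ∧ ε ≤ 1 := by
    filter_upwards [Ioc_mem_nhdsGT (zero_lt_one (α := ℝ))] with ε hε using hε
  -- the renewal equation
  set a : Fin J → ℝ := fun j => Real.log (r j)⁻¹ with ha'
  set p : Fin J → ℝ := fun j => r j ^ D with hp'
  have hp : ∀ j, 0 < p j := fun j => Real.rpow_pos_of_pos (hr j) D
  have ha : ∀ j, 0 < a j := fun j => Real.log_pos ((one_lt_inv₀ (hr j)).2 (hr1 j))
  have hμ0 : 0 < ∑ j, p j * a j :=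
    Finset.sum_pos (fun j _ => mul_pos (hp j) (ha j)) ⟨⟨0, by omega⟩, Finset.mem_univ _⟩
  set Z := logRescale α f with hZ
  set z := logRescale α h with hz
  have hZrec : ∀ t, Z t = z t + ∑ j, p j * Z (t - a j) := logRescale_renewal hr hrec
  have hzsum : ∀ t, z t = ∑ q, logRescale α (innerTubeVolume (G q)) t := fun t => by
    simp only [hz, hh, logRescale, Finset.mul_sum]
  have hzint := fun q => integrable_logRescale_and_integral_eq hDd hD₀d (hg q) (hk q) (hk' q)
  set I := ∑ q, ∑ m ∈ Finset.range (d + 1), inradius (G q) ^ (D - m) / (D - m) * κ q m with hI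
  have hzI : Integrable z ∧ ∫ t, z t = I := by
    rw [funext hzsum]
    exact ⟨integrable_finsetSum _ fun q _ => (hzint q).1, by
      rw [integral_finsetSum _ fun q _ => (hzint q).1]
      exact Finset.sum_congr rfl fun q _ => (hzint q).2⟩
  have hZint : ∀ s t, IntervalIntegrable Z volume s t := intervalIntegrable_logRescale hfmono
  have hZbot : Tendsto Z atBot (𝓝 0) := tendsto_logRescale_atBot hα0 hf0 hfV
  have hW := tendsto_sum_integral_renewal hmoran hZrec ha hZint hzI.1 hZbot
  rw [hzI.2] at hW
  have hztop : Tendsto z atTop (𝓝 0) := tendsto_logRescale_atTop hα1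
    (Eventually.of_forall hh0) (hev.mono fun ε hε => hhA ε hε.1)
  -- passage from the hull to the whole neighbourhood
  have hexc : Tendsto (fun ε => (tubeVolume F ε - f ε) * ε ^ (-α)) (𝓝[>] 0) (𝓝 0) := by
    refine tendsto_logRescale_iff.1 (tendsto_logRescale_atTop (A := K) hα1
      (Eventually.of_forall fun ε => sub_nonneg.2 (hlow ε)) (hev.mono fun ε hε => ?_))
    linarith [hup ε hε.1.le hε.2]
  have hZV : ∀ L, Tendsto Z atTop (𝓝 L) ↔
      Tendsto (fun ε => tubeVolume F ε * ε ^ (minkowskiDim F - d)) (𝓝[>] 0) (𝓝 L) := fun L => by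
    rw [← hD, show D - d = -α by rw [hα]; ring, tendsto_logRescale_iff]
    constructor
    · intro hL
      simpa using (hL.add hexc).congr fun ε => by ring
    · intro hL
      simpa using (hL.sub hexc).congr fun ε => by ring
  -- Since d-1 < D < d, the factors 1/(s - m) have no pole at D.
  have hDm : ∀ m ∈ Finset.range (d + 1), (m : ℝ) ≠ D := fun m hm hmD => by
    rcases (Nat.lt_succ_iff.1 (Finset.mem_range.1 hm)).eq_or_lt with h1 | h1
    · rw [h1] at hmD; linarith
    · have : (m : ℝ) + 1 ≤ d := by exact_mod_cast h1
      linarith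
  have hres : ∀ q, AnalyticAt ℂ (fun s : ℂ => ∑ m ∈ Finset.range (d + 1),
      (inradius (G q) : ℂ) ^ (s - m) / (s - m) * (κ q m : ℂ)) D := fun q =>
    analyticAt_sum_cpow_div (hg q) hDm
  refine ⟨hmoran, ?_, I / ∑ j, p j * a j, fun q => (∑ m ∈ Finset.range (d + 1),
    inradius (G q) ^ (D - m) / (D - m) * κ q m) / ∑ j, p j * a j, ?_, ?_, ?_, ?_, rfl, ?_, ?_⟩
  · rw [← hDα]
    refine tendsto_sub_log_div_log (B := B + K) hc (hev.mono fun ε hε => ?_)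
      (hev.mono fun ε hε => ?_)
    · exact (hcf ε hε.1 hε.2).trans (hlow ε)
    · have h1 : ε ≤ ε ^ α := by
        simpa using Real.rpow_le_rpow_of_exponent_ge hε.1 hε.2 hα1.le
      linarith [hup ε hε.1.le hε.2, hB ε hε.1, mul_le_mul_of_nonneg_left h1 hK0]
  · intro ε hε
    refine hasResidueAt_scalingZeta_mul hr hmoran hμ0.ne'
      (Finset.analyticAt_fun_sum Finset.univ fun q _ => hres q) ?_ fun s => ?_
    · rw [hI, Complex.ofReal_sum]
      exact Finset.sum_congr rfl fun q _ => sum_cpow_div_ofReal (hg q) D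
    · rw [totalGeometricZeta, Finset.sum_mul, Finset.mul_sum]
      exact Finset.sum_congr rfl fun q _ => geometricZeta_mul_cpow (G q) hε s
  · intro q ε hε
    exact hasResidueAt_scalingZeta_mul hr hmoran hμ0.ne' (hres q)
      (sum_cpow_div_ofReal (hg q) D) (geometricZeta_mul_cpow (G q) hε)
  · rw [hI, Finset.sum_div]
  · refine ⟨1 / ∑ j, p j * a j, ?_, by rw [one_div_mul_eq_div]⟩
    exact hasResidueAt_scalingZeta_mul (K := fun _ => 1) hr hmoran hμ0.ne' analyticAt_const
      Complex.ofReal_one.symm fun s => (mul_one _).symm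
  · intro hlat
    have hdense : Dense (AddSubgroup.closure (range a) : Set ℝ) := by
      rw [ha', closure_range_log_inv]
      refine (AddSubgroup.dense_or_cyclic _).resolve_right ?_
      rintro ⟨η, hη⟩
      refine hlat ?_
      rw [IsLatticeType, hη, ← AddSubgroup.zmultiples_eq_closure]
      infer_instance
    have hZlim := tendsto_of_renewal_of_dense hp hmoran hZrec ha hZint hztop hW
      (fun t => mul_nonneg (Real.exp_pos _).le (hf0 _)) (B := B) (fun t => ?_) hα0.le
      (fun s t hst => logRescale_le_exp_mul hfmono hst) hdense
    -- The content is nonzero because the critical lower bound keeps Z above c for small ε.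
    · refine ⟨ne_of_gt (hc.trans_le ?_), (hZV _).1 hZlim⟩
      refine ge_of_tendsto (tendsto_logRescale_iff.1 hZlim) (hev.mono fun ε hε => ?_)
      have := mul_le_mul_of_nonneg_right (hcf ε hε.1 hε.2) (Real.rpow_pos_of_pos hε.1 (-α)).le
      rwa [mul_assoc, ← Real.rpow_add hε.1, add_neg_cancel, Real.rpow_zero, mul_one] at this
    · have := mul_le_mul_of_nonneg_left (hB _ (Real.exp_pos (-t))) (Real.exp_pos (α * t)).le
      refine this.trans (le_of_eq ?_)
      rw [← Real.exp_mul, mul_left_comm, ← Real.exp_add]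
      simp [mul_comm]
  · intro hlat
    constructor
    · rintro ⟨L, hL0, hL⟩
      obtain ⟨η, hη⟩ : ∃ η, AddSubgroup.closure (range a) = AddSubgroup.zmultiples η := by
        rw [ha', closure_range_log_inv]
        have := AddSubgroup.discrete_iff_addCyclic.2 hlat
        obtain ⟨η, hη⟩ := (AddSubgroup.isAddCyclic_iff_exists_zmultiples_eq_top _).1 this
        exact ⟨η, hη.symm⟩
      have hη' : AddSubgroup.zmultiples |η| = AddSubgroup.zmultiples η := by
        rcases abs_choice η with h1 | h1 <;> rw [h1]
        exact AddSubgroup.zmultiples_neg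
      have haη : ∀ j, a j ∈ AddSubgroup.zmultiples |η| := fun j => by
        rw [hη', ← hη]
        exact AddSubgroup.subset_closure ⟨j, rfl⟩
      -- The generator is nonzero because the group contains the positive numbers a_j.
      have hη0 : 0 < |η| := by
        rw [abs_pos]
        rintro rfl
        have h1 := haη ⟨0, by omega⟩
        rw [abs_zero, AddSubgroup.zmultiples_zero_eq_bot, AddSubgroup.mem_bot] at h1
        exact (ha _).ne' h1
      refine hL0 (eq_zero_of_tendsto_of_lattice hp hmoran ha hZrec hZbot hη0 haη hDm hzsum
        (c := fun q => -Real.log (inradius (G q))) (v := fun q => -κ q d)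
        (fun q t ht => logRescale_eq_sum (hg q) (hk q) ht)
        (fun q t ht => logRescale_eq_const_mul (hg q) (hk' q) ht) ((hZV L).2 hL))
    · have havg := tendsto_average_of_le hVmono hfmono hα1 hlow hup
        (tendsto_average_of_renewal hp hmoran ha hZint hW)
      rw [HasAverageMinkowskiContent, ← hD]
      refine (havg.comp Real.tendsto_log_atTop).congr' ?_
      filter_upwards [eventually_ge_atTop 1] with T hT
      rw [integral_rpow_mul_div_eq _ hT, Function.comp_apply, one_div_mul_eq_div]
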